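/- Let $(X,Y)$ be a random pair in $\mathbb{R}^d\times\mathbb{R}$ with $\mathbb{E}\|X\|^2<\infty$ and $\mathbb{E}|Y|<\infty$ such that $\Sigma:=\mathbb{E}[XX^\top]$ is invertible, and let $\beta:=\Sigma^{-1}\mathbb{E}[XY]$. Let $(X_1,Y_1),\dots,(X_n,Y_n)$ be independent copies of $(X,Y)$, let $\hat\Sigma:=\frac1n\sum_{i=1}^n X_iX_i^\top$ and, when $\hat\Sigma$ is invertible, let $\hat\beta_{\mathrm{ols}}:=\hat\Sigma^{-1}\bigl(\frac1n\sum_{i=1}^n X_iY_i\bigr)$. Write $\|\cdot\|$ for the Euclidean norm of vectors and the spectral norm of matrices, and $\|x\|_\Sigma:=\sqrt{x^\top\Sigma x}$. Assume that the linear model is correct, $\mathbb{E}[Y\mid X]=X^\top\beta$ almost surely, and that the noise $\eta:=Y-\mathbb{E}[Y\mid X]$ is subgaussian: for some $\sigma\ge 0$ and every $\lambda\in\mathbb{R}$, almost surely $\mathbb{E}[e^{\lambda\eta}\mid X]\le e^{\lambda^2\sigma^2/2}$. Fix $\delta\in(0,1)$. (1) Suppose that for some $\rho_1\ge 1$ one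 has $\mathbb{E}\bigl[\exp(\alpha^\top\Sigma^{-1/2}X)\bigr]\le\exp(\rho_1\|\alpha\|^2/2)$ for all $\alpha\in\mathbb{R}^d$. Put $$n_{1,\delta}:=70\rho_1^2\bigl(d\log 41+\log(2/\delta)\bigr),\qquad K_{1,\delta,n}:=\frac{1}{1-\frac{10\rho_1}{9}\Bigl(\sqrt{\frac{32(d\log 41+\log(2/\delta))}{n}}+\frac{2(d\log 41+\log(2/\delta))}{n}\Bigr)}.$$ If $n>n_{1,\delta}$, then $K_{1,\delta,n}\le 5$ and, with probability at least $1-2\delta$, all of the following hold simultaneously: $\hat\Sigma$ is positive definite, $$\bigl\|\Sigma^{1/2}\hat\Sigma^{-1}\Sigma^{1/2}\bigr\|\le K_{1,\delta,n},\qquad\text{and}\qquad \|\hat\beta_{\mathrm{ols}}-\beta\|_\Sigma^2\le K_{1,\delta,n}\cdot\frac{\sigma^2\bigl(d+2\sqrt{d\log(1/\delta)}+2\log(1/\delta)\bigr)}{n}.$$ (2) Suppose that for some $\rho_2\ge 1$ one has $\|\Sigma^{-1/2}X\|/\sqrt d\le\rho_2$ almost surely. Put $$n_{2,\delta}:=4\rho_2^2\,d\log(d/\delta),\qquad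 K_{2,\delta,n}:=\frac{1}{1-\sqrt{\frac{2\rho_2^2\,d\log(d/\delta)}{n}}}.$$ If $n>n_{2,\delta}$, then $K_{2,\delta,n}\le 5$ and, with probability at least $1-2\delta$, all of the following hold simultaneously: $\hat\Sigma$ is positive definite, $$\bigl\|\Sigma^{1/2}\hat\Sigma^{-1}\Sigma^{1/2}\bigr\|\le K_{2,\delta,n},\qquad\text{and}\qquad \|\hat\beta_{\mathrm{ols}}-\beta\|_\Sigma^2\le K_{2,\delta,n}\cdot\frac{\sigma^2\bigl(d+2\sqrt{d\log(1/\delta)}+2\log(1/\delta)\bigr)}{n}.$$ -/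

import Mathlib

open MeasureTheory ProbabilityTheory
open scoped Matrix MatrixOrder

noncomputable section

namespace RandomDesign

/-- Covariate space `ℝ^d` with its Euclidean norm. -/
abbrev Vec (d : ℕ) : Type := EuclideanSpace ℝ (Fin d)

/-- Real `d × d` matrices. -/
abbrev Mat (d : ℕ) : Type := Matrix (Fin d) (Fin d) ℝ

/-- The matrix-vector product `A x`, as a vector of Euclidean space. -/
def app {d : ℕ} (A : Mat d) (x : Vec d) : Vec d :=
  Matrix.toEuclideanCLM (n := Fin d) (𝕜 := ℝ) A x

/-- The spectral norm of a matrix: the operator norm for the Euclidean vector norm. -/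
def specNorm {d : ℕ} (A : Mat d) : ℝ :=
  ‖Matrix.toEuclideanCLM (n := Fin d) (𝕜 := ℝ) A‖

/-- `‖x‖_M = √(xᵀ M x)`. -/
def mNorm {d : ℕ} (M : Mat d) (x : Vec d) : ℝ :=
  Real.sqrt (inner ℝ x (app M x))

/-- The positive semidefinite square root `M^{1/2}` of a positive semidefinite matrix. -/
def sqrtM {d : ℕ} (M : Mat d) : Mat d := CFC.sqrt M

section Population

variable {Ω : Type*} [MeasurableSpace Ω] {d : ℕ}

/-- The second moment matrix `Σ = E[X Xᵀ]`. -/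
def secondMoment (P : Measure Ω) (X : Ω → Vec d) : Mat d :=
  Matrix.of fun i j => ∫ ω, X ω i * X ω j ∂P

/-- `β = Σ⁻¹ E[X Y]`. -/
def betaStar (P : Measure Ω) (X : Ω → Vec d) (Y : Ω → ℝ) : Vec d :=
  app (secondMoment P X)⁻¹ (∫ ω, Y ω • X ω ∂P)

/-- The regression function `E[Y | X]`, as a random variable. -/
def regression (P : Measure Ω) (X : Ω → Vec d) (Y : Ω → ℝ) : Ω → ℝ :=
  P[Y | MeasurableSpace.comap X inferInstance]

/-- `noise(X) = Y - E[Y | X]`. -/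
def noise (P : Measure Ω) (X : Ω → Vec d) (Y : Ω → ℝ) : Ω → ℝ :=
  fun ω => Y ω - regression P X Y ω

/-- `bias(X) = E[Y | X] - Xᵀ β`. -/
def bias (P : Measure Ω) (X : Ω → Vec d) (Y : Ω → ℝ) : Ω → ℝ :=
  fun ω => regression P X Y ω - inner ℝ (X ω) (betaStar P X Y)

/-- The whitened covariate `Σ^{-1/2} X`. -/
def whitened (P : Measure Ω) (X : Ω → Vec d) : Ω → Vec d :=
  fun ω => app (sqrtM (secondMoment P X))⁻¹ (X ω)

/-- Subgaussian noise: for every `t`, almost surely `E[exp(t noise(X)) | X] ≤ exp(t² σ² / 2)`.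
Integrability of `exp(t noise(X))` (which the bound entails) is stated, because the conditional
expectation of a non-integrable function is `0` by convention. -/
def SubgaussianNoise (P : Measure Ω) (X : Ω → Vec d) (Y : Ω → ℝ) (σ : ℝ) : Prop :=
  0 ≤ σ ∧ ∀ t : ℝ,
    Integrable (fun ω => Real.exp (t * noise P X Y ω)) P ∧
    ∀ᵐ ω ∂P,
      (P[fun ω' => Real.exp (t * noise P X Y ω') | MeasurableSpace.comap X inferInstance]) ω
        ≤ Real.exp (t ^ 2 * σ ^ 2 / 2)

/-- Subgaussian projections: `E[exp(αᵀ Σ^{-1/2} X)] ≤ exp(ρ ‖α‖² / 2)` for every `α`. -/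
def SubgaussianProjections (P : Measure Ω) (X : Ω → Vec d) (ρ : ℝ) : Prop :=
  1 ≤ ρ ∧ ∀ α : Vec d,
    Integrable (fun ω => Real.exp (inner ℝ α (whitened P X ω))) P ∧
    ∫ ω, Real.exp (inner ℝ α (whitened P X ω)) ∂P ≤ Real.exp (ρ * ‖α‖ ^ 2 / 2)

/-- Bounded statistical leverage: `‖Σ^{-1/2} X‖ / √d ≤ ρ` almost surely. -/
def BoundedLeverage (P : Measure Ω) (X : Ω → Vec d) (ρ : ℝ) : Prop :=
  1 ≤ ρ ∧ ∀ᵐ ω ∂P, ‖whitened P X ω‖ / Real.sqrt d ≤ ρ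

end Population

section Sample

variable {d n : ℕ}

/-- The empirical second moment matrix `Σ̂ = (1/n) ∑ᵢ xᵢ xᵢᵀ`. -/
def empSecondMoment (x : Fin n → Vec d) : Mat d :=
  Matrix.of fun i j => (∑ k, x k i * x k j) / n

/-- The ordinary least squares estimator `Σ̂⁻¹ ((1/n) ∑ᵢ yᵢ xᵢ)`, for invertible `Σ̂`. -/
def ols (x : Fin n → Vec d) (y : Fin n → ℝ) : Vec d :=
  app (empSecondMoment x)⁻¹ ((n : ℝ)⁻¹ • ∑ k, y k • x k)

end Sample

/-- `n_{1,δ} = 70 ρ² (d log 41 + log(2/δ))`. -/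
def n₁ (d : ℕ) (ρ δ : ℝ) : ℝ :=
  70 * ρ ^ 2 * (d * Real.log 41 + Real.log (2 / δ))

/-- `n_{2,δ} = 4 ρ² d log(d/δ)`. -/
def n₂ (d : ℕ) (ρ δ : ℝ) : ℝ :=
  4 * ρ ^ 2 * d * Real.log (d / δ)

/-- `K_{1,δ,n}`. -/
def K₁ (d : ℕ) (ρ δ : ℝ) (n : ℕ) : ℝ :=
  1 / (1 - 10 * ρ / 9 *
    (Real.sqrt (32 * (d * Real.log 41 + Real.log (2 / δ)) / n)
      + 2 * (d * Real.log 41 + Real.log (2 / δ)) / n))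

/-- `K_{2,δ,n}`. -/
def K₂ (d : ℕ) (ρ δ : ℝ) (n : ℕ) : ℝ :=
  1 / (1 - Real.sqrt (2 * ρ ^ 2 * d * Real.log (d / δ) / n))

/-- The fixed design rate `σ² (d + 2 √(d log(1/δ)) + 2 log(1/δ)) / n`. -/
def rate (d : ℕ) (σ δ : ℝ) (n : ℕ) : ℝ :=
  σ ^ 2 * (d + 2 * Real.sqrt (d * Real.log (1 / δ)) + 2 * Real.log (1 / δ)) / n

end RandomDesign

end

/-!
If `K⁻¹ Σ ≤ Σ̂` in the Loewner order, then `‖Σ^{1/2} Σ̂⁻¹ Σ^{1/2}‖ ≤ K` and `‖b‖²_Σ ≤ K ‖b‖²_Σ̂`.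
So it is enough to bound `Σ̂` from below and the error of least squares in the empirical norm from
above, each with probability `1 - δ`.

The squared empirical error is `1/n` times the squared norm of the projection of the noise vector
onto the column space of the design. Gram–Schmidt gives an orthonormal frame of that space which
depends measurably on the design, so that, conditionally on the design, the projection is a
subgaussian vector in at most `d` dimensions; integrating its moment generating function against a
Gaussian yields the tail `d + 2 √(d log(1/δ)) + 2 log(1/δ)`.

Whitening reduces the lower bound on `Σ̂` to an isotropic design. If its projections are
subgaussian, their squares are sub-gamma, and a union bound over a `1/20`-net of the sphere with at
most `41 ^ d` points controls all directions. If its norm is bounded, the matrix Chernoff bound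
applies: `E tr exp(-θ ∑ wᵢ wᵢᵀ)` is estimated one summand at a time by the Golden–Thompson
inequality, itself a limit of trace inequalities through the Lie product formula.
-/

noncomputable section

namespace RandomDesign

section LieProduct

open NormedSpace Filter Topology

variable {𝔸 : Type*} [NormedRing 𝔸]

theorem exp_eq_exp_inv_smul_pow (𝕜 : Type*) [RCLike 𝕜] [NormedAlgebra 𝕜 𝔸] [CompleteSpace 𝔸]
    (a : 𝔸) {n : ℕ} (hn : n ≠ 0) :
    exp a = exp ((n : 𝕜)⁻¹ • a) ^ n := by
  let _ : NormedAlgebra ℚ 𝔸 := NormedAlgebra.restrictScalars ℚ 𝕜 𝔸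
  rw [← exp_nsmul, ← Nat.cast_smul_eq_nsmul 𝕜, smul_inv_smul₀ (Nat.cast_ne_zero.2 hn)]

variable [NormOneClass 𝔸]

theorem norm_pow_sub_pow_le {x y : 𝔸} {M : ℝ} (hx : ‖x‖ ≤ M) (hy : ‖y‖ ≤ M) (n : ℕ) :
    ‖x ^ n - y ^ n‖ ≤ n * M ^ (n - 1) * ‖x - y‖ := by
  have hM : 0 ≤ M := (norm_nonneg x).trans hx
  induction n with
  | zero => simp
  | succ n ih =>
    have hpow : (n : ℝ) * M ^ (n - 1) * M = n * M ^ n := by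
      cases n <;> simp [pow_succ, mul_assoc]
    calc ‖x ^ (n + 1) - y ^ (n + 1)‖ = ‖x ^ n * (x - y) + (x ^ n - y ^ n) * y‖ := by
          rw [pow_succ, pow_succ]; noncomm_ring
      _ ≤ ‖x ^ n‖ * ‖x - y‖ + ‖x ^ n - y ^ n‖ * ‖y‖ :=
          (norm_add_le _ _).trans (add_le_add (norm_mul_le _ _) (norm_mul_le _ _))
      _ ≤ M ^ n * ‖x - y‖ + n * M ^ (n - 1) * ‖x - y‖ * M := by
          gcongr
          exact (norm_pow_le x n).trans (pow_le_pow_left₀ (norm_nonneg x) hx n)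
      _ = ↑(n + 1) * M ^ (n + 1 - 1) * ‖x - y‖ := by
          rw [mul_right_comm, hpow, Nat.add_sub_cancel]; push_cast; ring

variable (𝕜 : Type*) [RCLike 𝕜] [NormedAlgebra 𝕜 𝔸] [CompleteSpace 𝔸]

include 𝕜 in
theorem norm_exp_le_exp_norm (x : 𝔸) : ‖exp x‖ ≤ Real.exp ‖x‖ := by
  have hsum : HasSum (fun k : ℕ => (k.factorial : ℝ)⁻¹ • ‖x‖ ^ k) (Real.exp ‖x‖) := by
    rw [Real.exp_eq_exp_ℝ]
    exact exp_series_hasSum_exp' (𝕂 := ℝ) ‖x‖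
  refine (exp_series_hasSum_exp' (𝕂 := 𝕜) x).norm_le_of_bounded hsum fun k => ?_
  rw [norm_smul, norm_inv, RCLike.norm_natCast, smul_eq_mul]
  gcongr
  exact norm_pow_le x k

theorem norm_exp_mul_exp_pow_sub_exp_add_le (a b : 𝔸) {n : ℕ} (hn : n ≠ 0) :
    ‖(exp ((n : 𝕜)⁻¹ • a) * exp ((n : 𝕜)⁻¹ • b)) ^ n - exp (a + b)‖ ≤
      n * Real.exp (‖a‖ + ‖b‖) *
        ‖exp ((n : 𝕜)⁻¹ • a) * exp ((n : 𝕜)⁻¹ • b) - exp ((n : 𝕜)⁻¹ • (a + b))‖ := by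
  set M : ℝ := Real.exp ((n : ℝ)⁻¹ * (‖a‖ + ‖b‖)) with hM
  have hM1 : 1 ≤ M := Real.one_le_exp (by positivity)
  have hMn : M ^ n = Real.exp (‖a‖ + ‖b‖) := by
    rw [hM, ← Real.exp_nat_mul, mul_inv_cancel_left₀ (Nat.cast_ne_zero.2 hn)]
  have hnorm : ∀ c : 𝔸, ‖(n : 𝕜)⁻¹ • c‖ = (n : ℝ)⁻¹ * ‖c‖ := fun c => by
    rw [norm_smul, norm_inv, RCLike.norm_natCast]
  have hmul : ‖exp ((n : 𝕜)⁻¹ • a) * exp ((n : 𝕜)⁻¹ • b)‖ ≤ M := by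
    rw [hM, mul_add, Real.exp_add, ← hnorm, ← hnorm]
    exact (norm_mul_le _ _).trans (mul_le_mul (norm_exp_le_exp_norm 𝕜 _)
      (norm_exp_le_exp_norm 𝕜 _) (norm_nonneg _) (Real.exp_pos _).le)
  have hadd : ‖exp ((n : 𝕜)⁻¹ • (a + b))‖ ≤ M := by
    refine (norm_exp_le_exp_norm 𝕜 _).trans (Real.exp_le_exp.2 ?_)
    rw [hnorm]
    gcongr
    exact norm_add_le a b
  rw [exp_eq_exp_inv_smul_pow 𝕜 (a + b) hn, ← hMn]
  refine (norm_pow_sub_pow_le hmul hadd n).trans ?_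
  gcongr
  exact n.sub_le 1

theorem tendsto_exp_mul_exp_pow (a b : 𝔸) :
    Tendsto (fun n : ℕ => (exp ((n : 𝕜)⁻¹ • a) * exp ((n : 𝕜)⁻¹ • b)) ^ n) atTop
      (𝓝 (exp (a + b))) := by
  let f : 𝕜 → 𝔸 := fun s => exp (s • a) * exp (s • b) - exp (s • (a + b))
  have hf : HasDerivAt f 0 0 := by
    simpa [f] using ((hasDerivAt_exp_smul_const a (0 : 𝕜)).fun_mul
      (hasDerivAt_exp_smul_const b (0 : 𝕜))).fun_sub (hasDerivAt_exp_smul_const (a + b) (0 : 𝕜))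
  have hinv : Tendsto (fun n : ℕ => (n : 𝕜)⁻¹) atTop (𝓝[≠] 0) :=
    tendsto_nhdsWithin_iff.2 ⟨tendsto_inv_atTop_nhds_zero_nat,
      (eventually_ne_atTop 0).mono fun n hn => inv_ne_zero (Nat.cast_ne_zero.2 hn)⟩
  have hlim : Tendsto (fun n : ℕ => (n : 𝕜) • f (n : 𝕜)⁻¹) atTop (𝓝 0) := by
    simpa [Function.comp_def, slope_def_module, f] using
      (hasDerivAt_iff_tendsto_slope.1 hf).comp hinv
  refine tendsto_iff_norm_sub_tendsto_zero.2 (squeeze_zero' (.of_forall fun n => norm_nonneg _)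
    ((eventually_ne_atTop 0).mono fun n hn => norm_exp_mul_exp_pow_sub_exp_add_le 𝕜 a b hn) ?_)
  simpa [norm_smul, f, mul_assoc, mul_left_comm] using
    hlim.norm.const_mul (Real.exp (‖a‖ + ‖b‖))

end LieProduct

section GoldenThompson

variable {𝕜 E : Type*} [RCLike 𝕜] [NormedAddCommGroup E] [InnerProductSpace 𝕜 E]

/-- The trace of a bounded operator, as a linear functional. It is a junk `0` in infinite
dimension. -/
def opTrace : (E →L[𝕜] E) →ₗ[𝕜] 𝕜 := LinearMap.trace 𝕜 E ∘ₗ ContinuousLinearMap.coeLM 𝕜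

theorem opTrace_mul_comm (A B : E →L[𝕜] E) : opTrace (A * B) = opTrace (B * A) :=
  LinearMap.trace_mul_comm 𝕜 (A : E →ₗ[𝕜] E) B

theorem opTrace_mul_pow_comm (A B : E →L[𝕜] E) (n : ℕ) :
    opTrace ((A * B) ^ n) = opTrace ((B * A) ^ n) := by
  cases n with
  | zero => simp
  | succ n => rw [pow_succ', mul_assoc, opTrace_mul_comm, mul_assoc, mul_pow_mul, ← mul_assoc,
      ← pow_succ']

theorem opTrace_eq_sum_inner {ι : Type*} [Fintype ι] (b : OrthonormalBasis ι 𝕜 E)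
    (A : E →L[𝕜] E) : opTrace A = ∑ i, inner 𝕜 (b i) (A (b i)) :=
  LinearMap.trace_eq_sum_inner (A : E →ₗ[𝕜] E) b

variable [CompleteSpace E]
open ContinuousLinearMap NormedSpace Filter Topology RCLike

theorem opTrace_star_mul_self {ι : Type*} [Fintype ι] (b : OrthonormalBasis ι 𝕜 E)
    (A : E →L[𝕜] E) : opTrace (star A * A) = ((∑ i, ‖A (b i)‖ ^ 2 : ℝ) : 𝕜) := by
  simp [opTrace_eq_sum_inner b, star_eq_adjoint, adjoint_inner_right, inner_self_eq_norm_sq_to_K]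

variable [FiniteDimensional 𝕜 E]

theorem norm_opTrace_star_mul_self (A : E →L[𝕜] E) :
    ‖opTrace (star A * A)‖ = re (opTrace (star A * A)) := by
  rw [opTrace_star_mul_self (stdOrthonormalBasis 𝕜 E), norm_ofReal, ofReal_re,
    abs_of_nonneg (by positivity)]

theorem norm_opTrace_mul_sq_le (A B : E →L[𝕜] E) :
    ‖opTrace (A * B)‖ ^ 2 ≤ re (opTrace (star A * A)) * re (opTrace (star B * B)) := by
  let b := stdOrthonormalBasis 𝕜 E
  have hA : re (opTrace (star A * A)) = ∑ i, ‖(star A) (b i)‖ ^ 2 := by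
    conv_lhs => rw [opTrace_mul_comm, ← star_star A]
    rw [star_star (star A), opTrace_star_mul_self b, ofReal_re]
  have hB : re (opTrace (star B * B)) = ∑ i, ‖B (b i)‖ ^ 2 := by
    rw [opTrace_star_mul_self b, ofReal_re]
  have hAB : ‖opTrace (A * B)‖ ≤ ∑ i, ‖(star A) (b i)‖ * ‖B (b i)‖ := by
    rw [opTrace_eq_sum_inner b]
    refine (norm_sum_le _ _).trans (Finset.sum_le_sum fun i _ => ?_)
    rw [star_eq_adjoint, mul_apply_eq_comp, ← adjoint_inner_left]
    exact norm_inner_le_norm _ _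
  calc ‖opTrace (A * B)‖ ^ 2 ≤ (∑ i, ‖(star A) (b i)‖ * ‖B (b i)‖) ^ 2 := by gcongr
    _ ≤ (∑ i, ‖(star A) (b i)‖ ^ 2) * ∑ i, ‖B (b i)‖ ^ 2 :=
        Finset.sum_mul_sq_le_sq_mul_sq _ _ _
    _ = _ := by rw [hA, hB]

/-- Hölder's inequality with exponents `1/p = 1/2p + 1/2p` for Schatten norms, at `p = 2 ^ k`. -/
theorem norm_opTrace_mul_pow_two_pow_sq_le (k : ℕ) (A B : E →L[𝕜] E) :
    ‖opTrace ((A * B) ^ 2 ^ k)‖ ^ 2 ≤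
      re (opTrace ((star A * A) ^ 2 ^ k)) * re (opTrace ((star B * B) ^ 2 ^ k)) := by
  induction k generalizing A B with
  | zero => simpa using norm_opTrace_mul_sq_le A B
  | succ k ih =>
    have hcycle : opTrace ((star (A * B) * (A * B)) ^ 2 ^ k) =
        opTrace ((star A * A * (B * star B)) ^ 2 ^ k) := by
      rw [star_mul, mul_assoc, opTrace_mul_pow_comm]
      simp only [mul_assoc]
    calc ‖opTrace ((A * B) ^ 2 ^ (k + 1))‖ ^ 2 = ‖opTrace (((A * B) * (A * B)) ^ 2 ^ k)‖ ^ 2 := by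
          rw [pow_succ' 2 k, pow_mul, sq (A * B)]
      _ ≤ re (opTrace ((star (A * B) * (A * B)) ^ 2 ^ k)) ^ 2 := (ih _ _).trans_eq (sq _).symm
      _ ≤ ‖opTrace ((star A * A * (B * star B)) ^ 2 ^ k)‖ ^ 2 := by
          rw [hcycle, ← sq_abs]
          gcongr
          exact abs_re_le_norm _
      _ ≤ re (opTrace ((star A * A) ^ 2 ^ (k + 1))) *
            re (opTrace ((B * star B) ^ 2 ^ (k + 1))) := by
          refine (ih _ _).trans_eq ?_
          simp only [star_mul, star_star, pow_succ' 2 k, pow_mul, sq]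
      _ = _ := by rw [opTrace_mul_pow_comm B]

theorem norm_opTrace_mul_pow_two_pow_le {A B : E →L[𝕜] E} (hA : IsSelfAdjoint A)
    (hB : IsSelfAdjoint B) (k : ℕ) :
    ‖opTrace ((A * B) ^ 2 ^ k)‖ ≤ ‖opTrace (A ^ 2 ^ k * B ^ 2 ^ k)‖ := by
  induction k generalizing A B with
  | zero => simp
  | succ k ih =>
    have hcycle : opTrace ((star (A * B) * (A * B)) ^ 2 ^ k) =
        opTrace ((A ^ 2 * B ^ 2) ^ 2 ^ k) := by
      rw [star_mul, hA.star_eq, hB.star_eq, mul_assoc, opTrace_mul_pow_comm]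
      simp only [mul_assoc, sq]
    have hstep : ‖opTrace ((A * B) ^ 2 ^ (k + 1))‖ ≤ ‖opTrace ((A ^ 2 * B ^ 2) ^ 2 ^ k)‖ := by
      refine (abs_le_of_sq_le_sq' ?_ (norm_nonneg _)).2
      rw [pow_succ' 2 k, pow_mul, sq (A * B), ← hcycle]
      refine (norm_opTrace_mul_pow_two_pow_sq_le k (A * B) (A * B)).trans ?_
      rw [← sq, ← sq_abs]
      gcongr
      exact abs_re_le_norm _
    refine hstep.trans ((ih (hA.pow 2) (hB.pow 2)).trans_eq ?_)
    rw [pow_succ' 2 k, pow_mul, pow_mul]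

theorem norm_opTrace_exp_add_le {A B : E →L[𝕜] E} (hA : IsSelfAdjoint A) (hB : IsSelfAdjoint B) :
    ‖opTrace (exp (A + B))‖ ≤ ‖opTrace (exp A * exp B)‖ := by
  rcases subsingleton_or_nontrivial E with hE | hE
  · simp [Subsingleton.elim (exp (A + B)) (exp A * exp B)]
  have hcont : Continuous (opTrace : (E →L[𝕜] E) → 𝕜) :=
    LinearMap.continuous_of_finiteDimensional _
  have hlim := ((hcont.norm.tendsto _).comp (tendsto_exp_mul_exp_pow 𝕜 A B)).comp
    (tendsto_pow_atTop_atTop_of_one_lt (one_lt_two (α := ℕ)))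
  refine le_of_tendsto' hlim fun k => ?_
  have hself : ∀ {C : E →L[𝕜] E}, IsSelfAdjoint C →
      IsSelfAdjoint (exp (((2 ^ k : ℕ) : 𝕜)⁻¹ • C)) := fun hC =>
    ((IsSelfAdjoint.natCast (2 ^ k)).inv₀.smul hC).exp
  refine (norm_opTrace_mul_pow_two_pow_le (hself hA) (hself hB) k).trans_eq ?_
  rw [← exp_eq_exp_inv_smul_pow 𝕜 A (by positivity),
    ← exp_eq_exp_inv_smul_pow 𝕜 B (by positivity)]

theorem norm_opTrace_exp_mul_exp {A B : E →L[𝕜] E} (hA : IsSelfAdjoint A)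
    (hB : IsSelfAdjoint B) :
    ‖opTrace (exp A * exp B)‖ = re (opTrace (exp A * exp B)) := by
  have hhalf : ∀ {C : E →L[𝕜] E}, IsSelfAdjoint C →
      star (exp ((2 : 𝕜)⁻¹ • C)) = exp ((2 : 𝕜)⁻¹ • C) := fun hC =>
    ((IsSelfAdjoint.ofNat 2).inv₀.smul hC).exp.star_eq
  let C := exp ((2 : 𝕜)⁻¹ • A) * exp ((2 : 𝕜)⁻¹ • B)
  have hC : opTrace (exp A * exp B) = opTrace (star C * C) := by
    rw [exp_eq_exp_inv_smul_pow 𝕜 A two_ne_zero, exp_eq_exp_inv_smul_pow 𝕜 B two_ne_zero, star_mul,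
      hhalf hA, hhalf hB, mul_assoc, opTrace_mul_comm (exp ((2 : 𝕜)⁻¹ • B))]
    simp only [C, sq, mul_assoc, Nat.cast_ofNat]
  rw [hC, norm_opTrace_star_mul_self]

theorem re_opTrace_exp_add_le {A B : E →L[𝕜] E} (hA : IsSelfAdjoint A) (hB : IsSelfAdjoint B) :
    re (opTrace (exp (A + B))) ≤ re (opTrace (exp A * exp B)) := by
  rw [← norm_opTrace_exp_mul_exp hA hB]
  exact (re_le_norm _).trans (norm_opTrace_exp_add_le hA hB)

end GoldenThompson

theorem lintegral_pi_succ {α : Type*} [MeasurableSpace α] (ν : Measure α) [SigmaFinite ν] {n : ℕ}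
    {f : (Fin (n + 1) → α) → ENNReal} (hf : Measurable f) :
    ∫⁻ z, f z ∂Measure.pi (fun _ => ν) =
      ∫⁻ x, ∫⁻ y, f (Fin.cons x y) ∂Measure.pi (fun _ : Fin n => ν) ∂ν := by
  have hcons := (measurePreserving_piFinSuccAbove (fun _ : Fin (n + 1) => ν) 0).symm
  rw [← hcons.lintegral_comp hf]
  refine (lintegral_prod (μ := ν) (ν := Measure.pi fun _ : Fin n => ν) _
    (hf.comp hcons.measurable).aemeasurable).trans ?_
  simp [MeasurableEquiv.piFinSuccAbove, Fin.insertNthEquiv]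

theorem sub_sq_div_two_le_one_sub_exp_neg {x : ℝ} (hx : 0 ≤ x) :
    x - x ^ 2 / 2 ≤ 1 - Real.exp (-x) := by
  have hinv : Real.exp (-x) * Real.exp x = 1 := by rw [← Real.exp_add]; simp
  nlinarith [sq_nonneg x, sq_nonneg (x ^ 2), mul_nonneg (Real.exp_pos (-x)).le
    (sub_nonneg.2 (Real.quadratic_le_exp_of_nonneg hx))]

section MatrixChernoff

variable {E : Type*} [NormedAddCommGroup E] [InnerProductSpace ℝ E]

open InnerProductSpace NormedSpace

theorem inner_apply_eq_sum_of_apply_eq_smul {ι : Type*} [Fintype ι] (b : OrthonormalBasis ι ℝ E)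
    {A : E →L[ℝ] E} {c : ι → ℝ} (hA : ∀ l, A (b l) = c l • b l) (w : E) :
    inner ℝ w (A w) = ∑ l, c l * inner ℝ (b l) w ^ 2 := by
  have hAw : A w = ∑ l, (c l * inner ℝ (b l) w) • b l := by
    conv_lhs => rw [← b.sum_repr' w]
    simp only [map_sum, map_smul, hA, smul_smul, mul_comm]
  rw [hAw, inner_sum]
  refine Finset.sum_congr rfl fun l _ => ?_
  rw [real_inner_smul_right, real_inner_comm]
  ring

theorem opTrace_eq_sum_of_apply_eq_smul {ι : Type*} [Fintype ι] (b : OrthonormalBasis ι ℝ E)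
    {A : E →L[ℝ] E} {c : ι → ℝ} (hA : ∀ l, A (b l) = c l • b l) : opTrace A = ∑ l, c l := by
  simp [opTrace_eq_sum_inner b, hA, inner_smul_right]

theorem inner_sum_rankOne_apply {ι : Type*} [Fintype ι] (w : ι → E) (v : E) :
    inner ℝ v ((∑ i, rankOne ℝ (w i) (w i)) v) = ∑ i, inner ℝ v (w i) ^ 2 := by
  simp [inner_sum, inner_smul_right, real_inner_comm v, sq]

variable [FiniteDimensional ℝ E]

theorem exp_apply_of_apply_eq_smul {T : E →L[ℝ] E} {v : E} {r : ℝ} (h : T v = r • v) :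
    exp T v = Real.exp r • v := by
  have hpow : ∀ k, (T ^ k) v = r ^ k • v := fun k => by
    induction k with
    | zero => simp
    | succ k ih => rw [pow_succ, mul_apply_eq_comp, h, map_smul, ih, smul_smul, pow_succ, mul_comm]
  have hT : HasSum (fun k : ℕ => ((k.factorial : ℝ)⁻¹ • T ^ k) v) (exp T v) :=
    (exp_series_hasSum_exp' (𝕂 := ℝ) T).mapL (ContinuousLinearMap.apply ℝ E v)
  have hr : HasSum (fun k : ℕ => ((k.factorial : ℝ)⁻¹ • r ^ k) • v) (Real.exp r • v) := by
    rw [Real.exp_eq_exp_ℝ]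
    exact (exp_series_hasSum_exp' (𝕂 := ℝ) r).smul_const v
  exact hT.unique (hr.congr_fun fun k => by simp [hpow, smul_smul])

theorem exp_smul_rankOne_self (t : ℝ) (w : E) :
    exp (t • rankOne ℝ w w) = 1 + ((Real.exp (t * ‖w‖ ^ 2) - 1) / ‖w‖ ^ 2) • rankOne ℝ w w := by
  rcases eq_or_ne w 0 with rfl | hw
  · simp
  have hw2 : ‖w‖ ^ 2 ≠ 0 := by positivity
  ext x
  set c : ℝ := inner ℝ w x / ‖w‖ ^ 2
  have hw_exp : exp (t • rankOne ℝ w w) w = Real.exp (t * ‖w‖ ^ 2) • w :=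
    exp_apply_of_apply_eq_smul (by simp [smul_smul])
  have hperp : exp (t • rankOne ℝ w w) (x - c • w) = x - c • w := by
    simpa using exp_apply_of_apply_eq_smul (T := t • rankOne ℝ w w) (v := x - c • w) (r := 0)
      (by simp [inner_sub_right, inner_smul_right, c, hw2])
  calc exp (t • rankOne ℝ w w) x
      = exp (t • rankOne ℝ w w) (x - c • w) + c • exp (t • rankOne ℝ w w) w := by
        conv_lhs => rw [← sub_add_cancel x (c • w), map_add, map_smul]
    _ = x + (c * (Real.exp (t * ‖w‖ ^ 2) - 1)) • w := by rw [hperp, hw_exp]; module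
    _ = _ := by
        simp only [add_apply, one_apply_eq_self, smul_apply, rankOne_apply, smul_smul, c]
        congr 2
        ring

theorem exists_orthonormalBasis_eigenvectors {A : E →L[ℝ] E} (hA : IsSelfAdjoint A) :
    ∃ (b : OrthonormalBasis (Fin (Module.finrank ℝ E)) ℝ E) (c : Fin (Module.finrank ℝ E) → ℝ),
      ∀ l, A (b l) = c l • b l :=
  ⟨hA.isSymmetric.eigenvectorBasis rfl, hA.isSymmetric.eigenvalues rfl,
    fun l => hA.isSymmetric.apply_eigenvectorBasis rfl l⟩

theorem opTrace_exp_nonneg {A : E →L[ℝ] E} (hA : IsSelfAdjoint A) : 0 ≤ opTrace (exp A) := by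
  obtain ⟨b, c, hc⟩ := exists_orthonormalBasis_eigenvectors hA
  rw [opTrace_eq_sum_of_apply_eq_smul b fun l => exp_apply_of_apply_eq_smul (hc l)]
  positivity

theorem exp_inner_apply_le_opTrace_exp {A : E →L[ℝ] E} (hA : IsSelfAdjoint A) {v : E}
    (hv : ‖v‖ = 1) : Real.exp (inner ℝ v (A v)) ≤ opTrace (exp A) := by
  obtain ⟨b, c, hc⟩ := exists_orthonormalBasis_eigenvectors hA
  have hsum : ∑ l, inner ℝ (b l) v ^ 2 = 1 := by
    simpa [hv] using b.sum_sq_inner_right v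
  calc Real.exp (inner ℝ v (A v)) = Real.exp (∑ l, inner ℝ (b l) v ^ 2 • c l) := by
        simp [inner_apply_eq_sum_of_apply_eq_smul b hc, mul_comm]
    _ ≤ ∑ l, inner ℝ (b l) v ^ 2 • Real.exp (c l) :=
        convexOn_exp.map_sum_le (fun l _ => sq_nonneg _) hsum fun _ _ => Set.mem_univ _
    _ ≤ ∑ l, Real.exp (c l) := by
        refine Finset.sum_le_sum fun l hl => mul_le_of_le_one_left (Real.exp_pos _).le ?_
        exact hsum ▸ Finset.single_le_sum (fun l _ => sq_nonneg (inner ℝ (b l) v)) hl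
    _ = opTrace (exp A) := (opTrace_eq_sum_of_apply_eq_smul b fun l =>
        exp_apply_of_apply_eq_smul (hc l)).symm

theorem mul_one_sub_exp_neg_le {θ r B : ℝ} (hr : 0 ≤ r) (hrB : r ≤ B) :
    r * (1 - Real.exp (-(θ * B))) ≤ B * (1 - Real.exp (-(θ * r))) := by
  rcases (hr.trans hrB).eq_or_lt with rfl | hB
  · simp [le_antisymm hrB hr]
  have hconv := convexOn_exp.2 (Set.mem_univ 0) (Set.mem_univ (-(θ * B)))
    (sub_nonneg.2 ((div_le_one hB).2 hrB)) (div_nonneg hr hB.le) (sub_add_cancel 1 (r / B))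
  have hpt : (1 - r / B) • (0 : ℝ) + (r / B) • -(θ * B) = -(θ * r) := by
    simp only [smul_eq_mul]; field_simp; ring
  rw [hpt, Real.exp_zero, smul_eq_mul, smul_eq_mul] at hconv
  calc r * (1 - Real.exp (-(θ * B)))
      = B * (1 - ((1 - r / B) * 1 + r / B * Real.exp (-(θ * B)))) := by field_simp; ring
    _ ≤ B * (1 - Real.exp (-(θ * r))) := by gcongr

theorem opTrace_mul_rankOne_self (A : E →L[ℝ] E) (w : E) :
    opTrace (A * rankOne ℝ w w) = inner ℝ w (A w) := by
  have hcomp : A * rankOne ℝ w w = rankOne ℝ (A w) w := comp_rankOne ..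
  rw [hcomp]
  exact trace_rankOne (A w) w

theorem inner_exp_apply_nonneg {A : E →L[ℝ] E} (hA : IsSelfAdjoint A) (w : E) :
    0 ≤ inner ℝ w (exp A w) := by
  obtain ⟨b, c, hc⟩ := exists_orthonormalBasis_eigenvectors hA
  rw [inner_apply_eq_sum_of_apply_eq_smul b fun l => exp_apply_of_apply_eq_smul (hc l)]
  positivity

theorem isSelfAdjoint_sub_smul_rankOne {A : E →L[ℝ] E} (hA : IsSelfAdjoint A) (θ : ℝ) (w : E) :
    IsSelfAdjoint (A - θ • rankOne ℝ w w) :=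
  hA.sub ((IsSelfAdjoint.all θ).smul (isPositive_rankOne_self w).isSelfAdjoint)

/-- The coefficient of `⟪w, e^A w⟫` is the chord of the convex function `r ↦ e^{-θ r}` over
`[0, B]`. -/
theorem opTrace_exp_sub_smul_rankOne_le {A : E →L[ℝ] E} (hA : IsSelfAdjoint A) {w : E}
    {θ B : ℝ} (hB : 0 < B) (hw : ‖w‖ ^ 2 ≤ B) :
    opTrace (exp (A - θ • rankOne ℝ w w)) ≤
      opTrace (exp A) - (1 - Real.exp (-(θ * B))) / B * inner ℝ w (exp A w) := by
  have hGT := re_opTrace_exp_add_le hA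
    ((IsSelfAdjoint.all (-θ)).smul (isPositive_rankOne_self w).isSelfAdjoint)
  rw [RCLike.re_to_real, RCLike.re_to_real, exp_smul_rankOne_self, mul_add, mul_one, mul_smul_comm,
    map_add, map_smul, opTrace_mul_rankOne_self, neg_smul, ← sub_eq_add_neg] at hGT
  refine hGT.trans ?_
  rcases eq_or_ne w 0 with rfl | hw0
  · simp
  have hchord : (1 - Real.exp (-(θ * B))) / B ≤
      (1 - Real.exp (-(θ * ‖w‖ ^ 2))) / ‖w‖ ^ 2 := by
    rw [div_le_div_iff₀ hB (by positivity)]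
    linarith [mul_one_sub_exp_neg_le (θ := θ) (sq_nonneg ‖w‖) hw]
  have hmul := mul_le_mul_of_nonneg_right hchord (inner_exp_apply_nonneg hA w)
  rw [← neg_sub 1, neg_div, neg_mul θ, smul_eq_mul, neg_mul]
  linarith

theorem exp_neg_mul_le_opTrace_exp {ι : Type*} [Fintype ι] {w : ι → E} {v : E} {θ m : ℝ}
    (hθ : 0 ≤ θ) (h : ∑ i, inner ℝ v (w i) ^ 2 < m * ‖v‖ ^ 2) :
    Real.exp (-(θ * m)) ≤ opTrace (exp (0 - θ • ∑ i, rankOne ℝ (w i) (w i))) := by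
  have hv : v ≠ 0 := by rintro rfl; simp at h
  have hA : IsSelfAdjoint (0 - θ • ∑ i, rankOne ℝ (w i) (w i)) :=
    (IsSelfAdjoint.zero _).sub ((IsSelfAdjoint.all θ).smul
      (isSelfAdjoint_sum _ fun i _ => (isPositive_rankOne_self (w i)).isSelfAdjoint))
  refine le_trans ?_ (exp_inner_apply_le_opTrace_exp hA (v := ‖v‖⁻¹ • v) (norm_smul_inv_norm hv))
  have hquad : inner ℝ (‖v‖⁻¹ • v) ((0 - θ • ∑ i, rankOne ℝ (w i) (w i)) (‖v‖⁻¹ • v)) =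
      -(θ * ((∑ i, inner ℝ v (w i) ^ 2) / ‖v‖ ^ 2)) := by
    rw [← inner_sum_rankOne_apply, zero_sub, neg_apply, smul_apply, map_smul, inner_neg_right,
      inner_smul_right, inner_smul_right, real_inner_smul_left]
    field_simp
  rw [hquad]
  gcongr
  exact (div_le_iff₀ (by positivity)).2 h.le

theorem continuous_opTrace_exp_sub_smul_sum_rankOne {ι : Type*} [Fintype ι] (A : E →L[ℝ] E)
    (θ : ℝ) : Continuous fun w : ι → E => opTrace (exp (A - θ • ∑ i, rankOne ℝ (w i) (w i))) := by
  have hrankOne : Continuous fun w : E => rankOne ℝ w w :=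
    ((rankOne ℝ : E →L[ℝ] E →L⋆[ℝ] E →L[ℝ] E).continuous.clm_apply continuous_id)
  have hexp : Continuous (exp : (E →L[ℝ] E) → E →L[ℝ] E) := by
    let _ := NormedAlgebra.restrictScalars ℚ ℝ (E →L[ℝ] E)
    exact exp_continuous
  have htrace : Continuous (opTrace : (E →L[ℝ] E) →ₗ[ℝ] ℝ) :=
    LinearMap.continuous_of_finiteDimensional _
  have hsum : Continuous fun w : ι → E => ∑ i, rankOne ℝ (w i) (w i) :=
    continuous_finsetSum _ fun i _ => hrankOne.comp (continuous_apply i)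
  exact htrace.comp (hexp.comp (continuous_const.sub (hsum.const_smul θ)))

variable [MeasurableSpace E]

/-- A law on `E` whose second moment operator is the identity. -/
structure IsIsotropic (ν : Measure E) : Prop where
  integrable_sq (v : E) : Integrable (fun w => inner ℝ v w ^ 2) ν
  integral_sq (v : E) : ∫ w, inner ℝ v w ^ 2 ∂ν = ‖v‖ ^ 2

namespace IsIsotropic

variable {ν : Measure E}

theorem integrable_inner_apply (hν : IsIsotropic ν) {A : E →L[ℝ] E} (hA : IsSelfAdjoint A) :
    Integrable (fun w => inner ℝ w (A w)) ν := by
  obtain ⟨b, c, hc⟩ := exists_orthonormalBasis_eigenvectors hA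
  simp only [inner_apply_eq_sum_of_apply_eq_smul b hc]
  exact integrable_finsetSum _ fun l _ => (hν.integrable_sq (b l)).const_mul _

theorem integral_inner_apply (hν : IsIsotropic ν) {A : E →L[ℝ] E} (hA : IsSelfAdjoint A) :
    ∫ w, inner ℝ w (A w) ∂ν = opTrace A := by
  obtain ⟨b, c, hc⟩ := exists_orthonormalBasis_eigenvectors hA
  simp only [inner_apply_eq_sum_of_apply_eq_smul b hc]
  rw [integral_finsetSum _ fun l _ => (hν.integrable_sq (b l)).const_mul _,
    opTrace_eq_sum_of_apply_eq_smul b hc]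
  simp [integral_const_mul, hν.integral_sq]

theorem lintegral_opTrace_exp_sub_smul_rankOne_le (hν : IsIsotropic ν) [IsProbabilityMeasure ν]
    {θ B : ℝ} (hB : 0 < B) (hbd : ∀ᵐ w ∂ν, ‖w‖ ^ 2 ≤ B) {A : E →L[ℝ] E} (hA : IsSelfAdjoint A) :
    ∫⁻ w, ENNReal.ofReal (opTrace (exp (A - θ • rankOne ℝ w w))) ∂ν ≤
      ENNReal.ofReal (Real.exp (-((1 - Real.exp (-(θ * B))) / B))) *
        ENNReal.ofReal (opTrace (exp A)) := by
  set c := (1 - Real.exp (-(θ * B))) / B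
  have hle : ∀ᵐ w ∂ν, opTrace (exp (A - θ • rankOne ℝ w w)) ≤
      opTrace (exp A) - c * inner ℝ w (exp A w) :=
    hbd.mono fun w hw => opTrace_exp_sub_smul_rankOne_le hA hB hw
  have hnonneg : ∀ᵐ w ∂ν, 0 ≤ opTrace (exp A) - c * inner ℝ w (exp A w) :=
    hle.mono fun w => (opTrace_exp_nonneg (isSelfAdjoint_sub_smul_rankOne hA θ w)).trans
  have hint : Integrable (fun w => c * inner ℝ w (exp A w)) ν :=
    (hν.integrable_inner_apply hA.exp).const_mul c
  calc ∫⁻ w, ENNReal.ofReal (opTrace (exp (A - θ • rankOne ℝ w w))) ∂ν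
      ≤ ∫⁻ w, ENNReal.ofReal (opTrace (exp A) - c * inner ℝ w (exp A w)) ∂ν :=
        lintegral_mono_ae (hle.mono fun w => ENNReal.ofReal_le_ofReal)
    _ = ENNReal.ofReal (∫ w, (opTrace (exp A) - c * inner ℝ w (exp A w)) ∂ν) :=
        (ofReal_integral_eq_lintegral_ofReal ((integrable_const _).sub hint) hnonneg).symm
    _ = ENNReal.ofReal ((-c + 1) * opTrace (exp A)) := by
        rw [integral_sub (integrable_const _) hint, integral_const_mul,
          hν.integral_inner_apply hA.exp, integral_const, probReal_univ, one_smul]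
        ring_nf
    _ ≤ _ := by
        rw [← ENNReal.ofReal_mul (Real.exp_pos _).le]
        gcongr
        exacts [opTrace_exp_nonneg hA, Real.add_one_le_exp _]

variable [BorelSpace E]

theorem lintegral_pi_opTrace_exp_sub_smul_sum_rankOne_le (hν : IsIsotropic ν)
    [IsProbabilityMeasure ν] {θ B : ℝ} (hB : 0 < B) (hbd : ∀ᵐ w ∂ν, ‖w‖ ^ 2 ≤ B) (n : ℕ)
    {A : E →L[ℝ] E} (hA : IsSelfAdjoint A) :
    ∫⁻ w, ENNReal.ofReal (opTrace (exp (A - θ • ∑ i, rankOne ℝ (w i) (w i))))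
        ∂Measure.pi (fun _ : Fin n => ν) ≤
      ENNReal.ofReal (Real.exp (-((1 - Real.exp (-(θ * B))) / B))) ^ n *
        ENNReal.ofReal (opTrace (exp A)) := by
  set q := ENNReal.ofReal (Real.exp (-((1 - Real.exp (-(θ * B))) / B)))
  induction n generalizing A with
  | zero => simp
  | succ n ih =>
    rw [lintegral_pi_succ ν
      (continuous_opTrace_exp_sub_smul_sum_rankOne A θ).measurable.ennreal_ofReal]
    simp only [Fin.sum_univ_succ, Fin.cons_zero, Fin.cons_succ, smul_add, ← sub_sub]
    calc ∫⁻ x, ∫⁻ y, ENNReal.ofReal (opTrace (exp (A - θ • rankOne ℝ x x -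
            θ • ∑ i, rankOne ℝ (y i) (y i)))) ∂Measure.pi (fun _ : Fin n => ν) ∂ν
        ≤ ∫⁻ x, q ^ n * ENNReal.ofReal (opTrace (exp (A - θ • rankOne ℝ x x))) ∂ν :=
          lintegral_mono fun x => ih (isSelfAdjoint_sub_smul_rankOne hA θ x)
      _ = q ^ n * ∫⁻ x, ENNReal.ofReal (opTrace (exp (A - θ • rankOne ℝ x x))) ∂ν :=
          lintegral_const_mul' _ _ (ENNReal.pow_ne_top ENNReal.ofReal_ne_top)
      _ ≤ q ^ n * (q * ENNReal.ofReal (opTrace (exp A))) := by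
          gcongr
          exact hν.lintegral_opTrace_exp_sub_smul_rankOne_le hB hbd hA
      _ = q ^ (n + 1) * ENNReal.ofReal (opTrace (exp A)) := by rw [pow_succ, mul_assoc]

/-- The rate is attained at `θ = t / B`. -/
theorem measure_pi_exists_sum_sq_lt_le_of_bounded (hν : IsIsotropic ν) [IsProbabilityMeasure ν]
    {B t : ℝ} (hB : 0 < B) (ht : 0 ≤ t) (hbd : ∀ᵐ w ∂ν, ‖w‖ ^ 2 ≤ B) (n : ℕ) :
    Measure.pi (fun _ : Fin n => ν)
        {w | ∃ v : E, ∑ i, inner ℝ v (w i) ^ 2 < n * (1 - t) * ‖v‖ ^ 2} ≤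
      ENNReal.ofReal (Module.finrank ℝ E * Real.exp (-(n * t ^ 2 / (2 * B)))) := by
  set a := Real.exp (-(t / B * (n * (1 - t)))) with ha
  set Φ : (Fin n → E) → ENNReal := fun w =>
    ENNReal.ofReal (opTrace (exp (0 - (t / B) • ∑ i, rankOne ℝ (w i) (w i))))
  have hΦ_meas : Measurable Φ :=
    (continuous_opTrace_exp_sub_smul_sum_rankOne 0 _).measurable.ennreal_ofReal
  have ha_pos : 0 < a := Real.exp_pos _
  have htrace : opTrace (exp (0 : E →L[ℝ] E)) = Module.finrank ℝ E := by
    simp [opTrace]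
  calc Measure.pi (fun _ : Fin n => ν)
        {w | ∃ v : E, ∑ i, inner ℝ v (w i) ^ 2 < n * (1 - t) * ‖v‖ ^ 2}
      ≤ Measure.pi (fun _ : Fin n => ν) {w | ENNReal.ofReal a ≤ Φ w} :=
        measure_mono fun w ⟨v, hv⟩ => ENNReal.ofReal_le_ofReal
          (exp_neg_mul_le_opTrace_exp (by positivity) hv)
    _ ≤ (∫⁻ w, Φ w ∂Measure.pi (fun _ : Fin n => ν)) / ENNReal.ofReal a :=
        meas_ge_le_lintegral_div hΦ_meas.aemeasurable (by simpa using ha_pos)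
          ENNReal.ofReal_ne_top
    _ ≤ ENNReal.ofReal (Real.exp (-((1 - Real.exp (-(t / B * B))) / B))) ^ n *
          ENNReal.ofReal (Module.finrank ℝ E) / ENNReal.ofReal a := by
        gcongr
        rw [← htrace]
        exact hν.lintegral_pi_opTrace_exp_sub_smul_sum_rankOne_le hB hbd n (IsSelfAdjoint.zero _)
    _ = ENNReal.ofReal (Module.finrank ℝ E *
          Real.exp (-(n * ((1 - Real.exp (-t)) / B)) + t / B * (n * (1 - t)))) := by
        rw [← ENNReal.ofReal_pow (by positivity), ← ENNReal.ofReal_mul (by positivity),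
          ← ENNReal.ofReal_div_of_pos ha_pos, ← Real.exp_nat_mul, mul_comm, mul_div_assoc, ha,
          ← Real.exp_sub, div_mul_cancel₀ _ hB.ne']
        ring_nf
    _ ≤ _ := by
        gcongr
        have hcalc : -(n * ((t - t ^ 2 / 2) / B)) + t / B * (n * (1 - t)) =
            -(n * t ^ 2 / (2 * B)) := by
          field_simp; ring
        rw [← hcalc]
        gcongr ?_ + _
        refine neg_le_neg (mul_le_mul_of_nonneg_left ?_ n.cast_nonneg)
        exact div_le_div_of_nonneg_right (sub_sq_div_two_le_one_sub_exp_neg ht) hB.le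

end IsIsotropic

end MatrixChernoff

section Subgamma

theorem lintegral_pi_prod {α : Type*} [MeasurableSpace α] {ν : Measure α} [SigmaFinite ν]
    {f : α → ENNReal} (hf : Measurable f) (n : ℕ) :
    ∫⁻ z, ∏ i, f (z i) ∂Measure.pi (fun _ : Fin n => ν) = (∫⁻ x, f x ∂ν) ^ n := by
  induction n with
  | zero => simp
  | succ n ih =>
    rw [lintegral_pi_succ ν (by fun_prop)]
    simp only [Fin.prod_univ_succ, Fin.cons_zero, Fin.cons_succ]
    have hinner : ∀ x, ∫⁻ y, f x * ∏ i, f (y i) ∂Measure.pi (fun _ : Fin n => ν) =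
        f x * (∫⁻ x, f x ∂ν) ^ n := fun x => by
      rw [lintegral_const_mul _ (by fun_prop), ih]
    simp only [hinner]
    rw [lintegral_mul_const _ hf, pow_succ, mul_comm]

theorem exists_subgamma_chernoff {v c s : ℝ} (hv : 0 < v) (hc : 0 ≤ c) (hs : 0 ≤ s) :
    ∃ η, 0 ≤ η ∧ c * η < 1 ∧
      v * η ^ 2 / (2 * (1 - c * η)) - η * (√(2 * v * s) + c * s) = -s := by
  set a := √(2 * s / v) with ha
  have ha0 : 0 ≤ a := Real.sqrt_nonneg _
  have hs' : s = v * a ^ 2 / 2 := by rw [ha, Real.sq_sqrt (by positivity)]; field_simp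
  have hsq : √(2 * v * s) = v * a := by
    rw [Real.sqrt_eq_iff_mul_self_eq (by positivity) (by positivity), hs']
    ring
  have : 0 < 1 + c * a := by positivity
  have hsub : 1 - c * (a / (1 + c * a)) = 1 / (1 + c * a) := by field_simp; ring
  refine ⟨a / (1 + c * a), by positivity, ?_, ?_⟩
  · rw [← sub_pos, hsub]
    positivity
  · rw [hsub, hsq, hs']
    field_simp
    ring

variable {Ω α : Type*} [MeasurableSpace Ω] [MeasurableSpace α] {μ : Measure Ω} {ν : Measure α}
  {f : Ω → ℝ} {v c s : ℝ}

/-- `f` is sub-gamma on the right with variance factor `v` and scale `c` under `μ`: its moment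
generating function is at most `exp (v t² / (2 (1 - c t)))` on `0 ≤ t < 1 / c`. The moment
generating function is a lower integral, so that the bound includes integrability. -/
def HasSubgammaMGF (f : Ω → ℝ) (v c : ℝ) (μ : Measure Ω) : Prop :=
  ∀ t : ℝ, 0 ≤ t → c * t < 1 →
    ∫⁻ ω, ENNReal.ofReal (Real.exp (t * f ω)) ∂μ ≤
      ENNReal.ofReal (Real.exp (v * t ^ 2 / (2 * (1 - c * t))))

namespace HasSubgammaMGF

theorem mono {w : ℝ} (h : HasSubgammaMGF f v c μ) (hvw : v ≤ w) : HasSubgammaMGF f w c μ := by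
  intro t ht hct
  have : 0 < 1 - c * t := sub_pos.2 hct
  exact (h t ht hct).trans (by gcongr)

theorem pi_sum {f : α → ℝ} [SigmaFinite ν] (hf : Measurable f) (h : HasSubgammaMGF f v c ν)
    (n : ℕ) :
    HasSubgammaMGF (fun z : Fin n → α => ∑ i, f (z i)) (n * v) c
      (Measure.pi fun _ => ν) := by
  intro t ht hct
  simp only [Finset.mul_sum, Real.exp_sum,
    ENNReal.ofReal_prod_of_nonneg fun _ _ => (Real.exp_pos _).le]
  rw [lintegral_pi_prod (f := fun x => ENNReal.ofReal (Real.exp (t * f x))) (by fun_prop)]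
  refine (pow_le_pow_left' (h t ht hct) n).trans_eq ?_
  rw [← ENNReal.ofReal_pow (Real.exp_pos _).le, ← Real.exp_nat_mul]
  congr 2
  ring

theorem measure_ge_le (h : HasSubgammaMGF f v c μ) (hf : Measurable f) (hv : 0 < v) (hc : 0 ≤ c)
    (hs : 0 ≤ s) :
    μ {ω | √(2 * v * s) + c * s ≤ f ω} ≤ ENNReal.ofReal (Real.exp (-s)) := by
  obtain ⟨t, ht, hct, hopt⟩ := exists_subgamma_chernoff hv hc hs
  set a := √(2 * v * s) + c * s
  calc μ {ω | a ≤ f ω}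
      ≤ μ {ω | ENNReal.ofReal (Real.exp (t * a)) ≤ ENNReal.ofReal (Real.exp (t * f ω))} :=
        measure_mono fun ω hω => ENNReal.ofReal_le_ofReal
          (Real.exp_le_exp.2 (mul_le_mul_of_nonneg_left hω ht))
    _ ≤ (∫⁻ ω, ENNReal.ofReal (Real.exp (t * f ω)) ∂μ) / ENNReal.ofReal (Real.exp (t * a)) :=
        meas_ge_le_lintegral_div (by fun_prop) (by simpa using Real.exp_pos _)
          ENNReal.ofReal_ne_top
    _ ≤ ENNReal.ofReal (Real.exp (v * t ^ 2 / (2 * (1 - c * t)))) /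
          ENNReal.ofReal (Real.exp (t * a)) := by
        gcongr
        exact h t ht hct
    _ = ENNReal.ofReal (Real.exp (-s)) := by
        rw [← ENNReal.ofReal_div_of_pos (Real.exp_pos _), ← Real.exp_sub, hopt]

/-- The inequality is strict because `f = 0` is allowed when `v = c = 0`. -/
theorem measure_gt_le (h : HasSubgammaMGF f v c μ) (hf : Measurable f) (hv : 0 ≤ v) (hc : 0 ≤ c)
    (hs : 0 ≤ s) :
    μ {ω | √(2 * v * s) + c * s < f ω} ≤ ENNReal.ofReal (Real.exp (-s)) := by
  set A : ℕ → Set Ω := fun k => {ω | √(2 * (v + 1 / ((k : ℝ) + 1)) * s) + c * s ≤ f ω}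
  have hA : Monotone A := fun k l hkl ω hω => by
    refine le_trans ?_ (show _ ≤ f ω from hω)
    gcongr
  have hlim : Filter.Tendsto
      (fun k : ℕ => √(2 * (v + 1 / ((k : ℝ) + 1)) * s) + c * s) Filter.atTop
      (nhds (√(2 * v * s) + c * s)) := by
    have h0 := tendsto_one_div_add_atTop_nhds_zero_nat (𝕜 := ℝ)
    simpa using (((h0.const_add v).const_mul 2).mul_const s).sqrt.add_const (c * s)
  have hsub : {ω | √(2 * v * s) + c * s < f ω} ⊆ ⋃ k, A k := fun ω hω =>
    Set.mem_iUnion.2 ((hlim.eventually_le_const hω).exists)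
  refine (measure_mono hsub).trans (hA.measure_iUnion.trans_le (iSup_le fun k => ?_))
  exact (h.mono (le_add_of_nonneg_right (by positivity))).measure_ge_le hf (by positivity) hc hs

end HasSubgammaMGF

end Subgamma

section SubgaussianVector

open Module

theorem neg_log_one_sub_le {y : ℝ} (hy0 : 0 ≤ y) (hy1 : y < 1) :
    -Real.log (1 - y) ≤ y + y ^ 2 / (2 * (1 - y)) := by
  have hpos : 0 < 1 - y := sub_pos.2 hy1
  have hlog : 0 ≤ -Real.log (1 - y) := neg_nonneg.2 (Real.log_nonpos hpos.le (by linarith))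
  have hsinh := Real.self_le_sinh_iff.2 hlog
  rw [Real.sinh_eq, neg_neg, Real.exp_neg, Real.exp_log hpos] at hsinh
  refine hsinh.trans_eq ?_
  field_simp
  ring

variable {Ω E : Type*} [MeasurableSpace Ω] {μ : Measure Ω}
  [NormedAddCommGroup E] [InnerProductSpace ℝ E] {S : Ω → E} {v : ℝ}

/-- The random vector `S` is subgaussian with variance factor `v`: every projection `⟪b, S⟫` has
moment generating function at most that of a centred Gaussian of variance `v ‖b‖²`. The moment
generating function is a lower integral, so that the bound includes integrability. -/
def HasSubgaussianVectorMGF (S : Ω → E) (v : ℝ) (μ : Measure Ω) : Prop :=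
  ∀ b : E, ∫⁻ ω, ENNReal.ofReal (Real.exp (inner ℝ b (S ω))) ∂μ ≤
    ENNReal.ofReal (Real.exp (v * ‖b‖ ^ 2 / 2))

variable [FiniteDimensional ℝ E] [MeasurableSpace E] [BorelSpace E]

theorem lintegral_exp_neg_mul_norm_sq {b : ℝ} (hb : 0 < b) :
    ∫⁻ x : E, ENNReal.ofReal (Real.exp (-b * ‖x‖ ^ 2)) =
      ENNReal.ofReal ((Real.pi / b) ^ (finrank ℝ E / 2 : ℝ)) := by
  have h := GaussianFourier.integral_rexp_neg_mul_sq_norm (V := E) hb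
  rw [← h, ofReal_integral_eq_lintegral_ofReal]
  · refine Integrable.of_integral_ne_zero ?_
    rw [h]
    positivity
  · exact Filter.Eventually.of_forall fun x => (Real.exp_pos _).le

theorem lintegral_exp_inner_sub_mul_norm_sq {t : ℝ} (ht : 0 < t) (x : E) :
    ∫⁻ b : E, ENNReal.ofReal (Real.exp (inner ℝ b x - ‖b‖ ^ 2 / (4 * t))) =
      ENNReal.ofReal ((4 * Real.pi * t) ^ (finrank ℝ E / 2 : ℝ)) *
        ENNReal.ofReal (Real.exp (t * ‖x‖ ^ 2)) := by
  have hsq : ∀ b : E, inner ℝ b x - ‖b‖ ^ 2 / (4 * t) =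
      -(1 / (4 * t)) * ‖b - (2 * t) • x‖ ^ 2 + t * ‖x‖ ^ 2 := by
    intro b
    rw [norm_sub_sq_real, inner_smul_right, norm_smul, Real.norm_of_nonneg (by positivity)]
    field_simp
    ring
  simp only [hsq, Real.exp_add, ENNReal.ofReal_mul (Real.exp_pos _).le]
  rw [lintegral_mul_const _ (by fun_prop),
    lintegral_sub_right_eq_self (fun b : E => ENNReal.ofReal (Real.exp (-(1 / (4 * t)) * ‖b‖ ^ 2))),
    lintegral_exp_neg_mul_norm_sq (by positivity)]
  congr 3
  field_simp

namespace HasSubgaussianVectorMGF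

/-- `exp (t ‖S‖²)` is, up to a constant, the mixture of the `exp ⟪b, S⟫` over a Gaussian `b`. -/
theorem lintegral_exp_mul_norm_sq_le [SFinite μ] (h : HasSubgaussianVectorMGF S v μ)
    (hS : Measurable S) {t : ℝ} (ht : 0 ≤ t) (hvt : 2 * v * t < 1) :
    ∫⁻ ω, ENNReal.ofReal (Real.exp (t * ‖S ω‖ ^ 2)) ∂μ ≤
      ENNReal.ofReal ((1 - 2 * v * t) ^ (-(finrank ℝ E : ℝ) / 2)) := by
  rcases ht.eq_or_lt with rfl | ht
  · simpa using h 0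
  have hpos : 0 < 1 - 2 * v * t := sub_pos.2 hvt
  set c := ENNReal.ofReal ((4 * Real.pi * t) ^ (finrank ℝ E / 2 : ℝ)) with hc
  have hc0 : c ≠ 0 := by simp only [hc, ne_eq, ENNReal.ofReal_eq_zero, not_le]; positivity
  refine (ENNReal.mul_le_mul_iff_right hc0 ENNReal.ofReal_ne_top).1 ?_
  calc c * ∫⁻ ω, ENNReal.ofReal (Real.exp (t * ‖S ω‖ ^ 2)) ∂μ
      = ∫⁻ ω, (∫⁻ b : E, ENNReal.ofReal (Real.exp (inner ℝ b (S ω) - ‖b‖ ^ 2 / (4 * t)))) ∂μ := by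
        simp only [lintegral_exp_inner_sub_mul_norm_sq ht]
        rw [lintegral_const_mul _ (by fun_prop)]
    _ = ∫⁻ b : E, ENNReal.ofReal (Real.exp (-(‖b‖ ^ 2 / (4 * t)))) *
          ∫⁻ ω, ENNReal.ofReal (Real.exp (inner ℝ b (S ω))) ∂μ := by
        rw [lintegral_lintegral_swap (by fun_prop)]
        refine lintegral_congr fun b => ?_
        rw [← lintegral_const_mul _ (by fun_prop)]
        simp only [← ENNReal.ofReal_mul (Real.exp_pos _).le, ← Real.exp_add, neg_add_eq_sub]
    _ ≤ ∫⁻ b : E, ENNReal.ofReal (Real.exp (-((1 - 2 * v * t) / (4 * t)) * ‖b‖ ^ 2)) := by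
        refine lintegral_mono fun b => (mul_le_mul_right (h b) _).trans_eq ?_
        rw [← ENNReal.ofReal_mul (Real.exp_pos _).le, ← Real.exp_add]
        congr 2
        field_simp
        ring
    _ = c * ENNReal.ofReal ((1 - 2 * v * t) ^ (-(finrank ℝ E : ℝ) / 2)) := by
        rw [lintegral_exp_neg_mul_norm_sq (by positivity), hc, ← ENNReal.ofReal_mul (by positivity),
          neg_div, Real.rpow_neg hpos.le, ← div_eq_mul_inv, ← Real.div_rpow (by positivity) hpos.le]
        congr 2
        field_simp

theorem hasSubgammaMGF_norm_sq [SFinite μ] (h : HasSubgaussianVectorMGF S v μ)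
    (hS : Measurable S) (hv : 0 ≤ v) :
    HasSubgammaMGF (fun ω => ‖S ω‖ ^ 2 - v * finrank ℝ E) (2 * finrank ℝ E * v ^ 2) (2 * v) μ := by
  intro t ht hvt
  have hpos : 0 < 1 - 2 * v * t := sub_pos.2 hvt
  have hlog := neg_log_one_sub_le (y := 2 * v * t) (by positivity) hvt
  have hsplit : ∀ ω, ENNReal.ofReal (Real.exp (t * (‖S ω‖ ^ 2 - v * finrank ℝ E))) =
      ENNReal.ofReal (Real.exp (-(t * (v * finrank ℝ E)))) *
        ENNReal.ofReal (Real.exp (t * ‖S ω‖ ^ 2)) := fun ω => by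
    rw [← ENNReal.ofReal_mul (Real.exp_pos _).le, ← Real.exp_add, mul_sub, neg_add_eq_sub]
  simp only [hsplit]
  rw [lintegral_const_mul' _ _ ENNReal.ofReal_ne_top]
  refine (mul_le_mul_right (h.lintegral_exp_mul_norm_sq_le hS ht hvt) _).trans ?_
  rw [← ENNReal.ofReal_mul (Real.exp_pos _).le, Real.rpow_def_of_pos hpos, ← Real.exp_add]
  gcongr
  calc -(t * (v * finrank ℝ E)) + Real.log (1 - 2 * v * t) * (-(finrank ℝ E : ℝ) / 2)
      = finrank ℝ E / 2 * (-Real.log (1 - 2 * v * t) - 2 * v * t) := by ring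
    _ ≤ finrank ℝ E / 2 * ((2 * v * t) ^ 2 / (2 * (1 - 2 * v * t))) := by
        gcongr
        linarith
    _ = _ := by ring

theorem measure_norm_sq_gt_le [SFinite μ] (h : HasSubgaussianVectorMGF S v μ) (hS : Measurable S)
    (hv : 0 ≤ v) {s : ℝ} (hs : 0 ≤ s) :
    μ {ω | v * (finrank ℝ E + 2 * √(finrank ℝ E * s) + 2 * s) < ‖S ω‖ ^ 2} ≤
      ENNReal.ofReal (Real.exp (-s)) := by
  have htail := (h.hasSubgammaMGF_norm_sq hS hv).measure_gt_le (by fun_prop) (by positivity)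
    (by positivity) hs
  have hsqrt : √(2 * (2 * finrank ℝ E * v ^ 2) * s) =
      2 * v * √(finrank ℝ E * s) := by
    rw [← Real.sqrt_sq (show 0 ≤ 2 * v by positivity), ← Real.sqrt_mul (by positivity)]
    ring_nf
  refine (measure_mono fun ω hω => ?_).trans htail
  simp only [Set.mem_ofPred_eq, hsqrt] at hω ⊢
  linarith

end HasSubgaussianVectorMGF

end SubgaussianVector

section SubgaussianSquare

theorem exp_mul_sub_one_sub_le {c u : ℝ} (hc0 : 0 ≤ c) (hc1 : c ≤ 1) (hu : 0 ≤ u) :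
    Real.exp (c * u) - 1 - c * u ≤ c ^ 2 * (Real.exp u - 1 - u) := by
  have hseries : ∀ x : ℝ, HasSum (fun k => x ^ (k + 2) / ((k + 2).factorial : ℝ))
      (Real.exp x - 1 - x) := fun x => by
    have h := (hasSum_nat_add_iff' 2).2 (NormedSpace.expSeries_div_hasSum_exp x)
    simpa [← Real.exp_eq_exp_ℝ, Finset.sum_range_succ, sub_sub] using h
  refine hasSum_le (fun k => ?_) (hseries (c * u)) ((hseries u).mul_left (c ^ 2))
  calc (c * u) ^ (k + 2) / ((k + 2).factorial : ℝ)
      = c ^ k * (c ^ 2 * (u ^ (k + 2) / ((k + 2).factorial : ℝ))) := by ring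
    _ ≤ 1 * (c ^ 2 * (u ^ (k + 2) / ((k + 2).factorial : ℝ))) := by
        gcongr
        exact pow_le_one₀ hc0 hc1
    _ = _ := one_mul _

theorem exp_sub_one_sub_le_exp_abs_sub_one_sub_abs (x : ℝ) :
    Real.exp x - 1 - x ≤ Real.exp |x| - 1 - |x| := by
  rcases le_total 0 x with hx | hx
  · rw [abs_of_nonneg hx]
  · rw [abs_of_nonpos hx]
    have h := Real.self_le_sinh_iff.2 (neg_nonneg.2 hx)
    rw [Real.sinh_eq, neg_neg] at h
    linarith

namespace HasSubgaussianVectorMGF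

variable {Ω E : Type*} [MeasurableSpace Ω] {μ : Measure Ω}
  [NormedAddCommGroup E] [InnerProductSpace ℝ E] {ρ : ℝ}

theorem inner_left {S : Ω → E} (h : HasSubgaussianVectorMGF S ρ μ) (u : E) :
    HasSubgaussianVectorMGF (fun ω => inner ℝ u (S ω)) (ρ * ‖u‖ ^ 2) μ := by
  intro b
  refine le_of_eq_of_le ?_ ((h (b • u)).trans_eq ?_)
  · simp [inner_smul_left, mul_comm]
  · rw [norm_smul]
    ring_nf

variable [IsProbabilityMeasure μ] {Z : Ω → ℝ}

theorem integrable_exp_mul_sq (h : HasSubgaussianVectorMGF Z ρ μ) (hZ : Measurable Z) {t : ℝ}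
    (ht : 0 ≤ t) (hρt : 2 * ρ * t < 1) : Integrable (fun ω => Real.exp (t * Z ω ^ 2)) μ := by
  have hle := h.lintegral_exp_mul_norm_sq_le hZ ht hρt
  simp only [Real.norm_eq_abs, sq_abs] at hle
  exact (lintegral_ofReal_ne_top_iff_integrable (by fun_prop)
    (.of_forall fun ω => (Real.exp_pos _).le)).1 (ne_top_of_le_ne_top ENNReal.ofReal_ne_top hle)

theorem integral_exp_mul_sq_sub_one_le (h : HasSubgaussianVectorMGF Z ρ μ) (hZ : Measurable Z)
    {t : ℝ} (ht : 0 ≤ t) (hρt : 2 * ρ * t < 1) :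
    ∫ ω, Real.exp (t * Z ω ^ 2) ∂μ - 1 ≤ ρ * t / (1 - 2 * ρ * t) := by
  have hpos : 0 < 1 - 2 * ρ * t := sub_pos.2 hρt
  have hle := h.lintegral_exp_mul_norm_sq_le hZ ht hρt
  simp only [Real.norm_eq_abs, sq_abs, Module.finrank_self, Nat.cast_one] at hle
  rw [← ofReal_integral_eq_lintegral_ofReal (h.integrable_exp_mul_sq hZ ht hρt)
    (.of_forall fun ω => (Real.exp_pos _).le), ENNReal.ofReal_le_ofReal_iff (by positivity)] at hle
  have hsq : ((1 - 2 * ρ * t) ^ (-1 / 2 : ℝ)) ^ 2 = 1 + 2 * (ρ * t / (1 - 2 * ρ * t)) := by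
    rw [← Real.rpow_mul_natCast hpos.le]
    norm_num [Real.rpow_neg_one]
    field_simp
    ring
  nlinarith [sq_nonneg ((1 - 2 * ρ * t) ^ (-1 / 2 : ℝ) - 1)]

theorem integrable_exp_mul_sq_sub_one_sub (h : HasSubgaussianVectorMGF Z ρ μ) (hZ : Measurable Z)
    (hZ2 : Integrable (fun ω => Z ω ^ 2) μ) {t : ℝ} (ht : 0 ≤ t) (hρt : 2 * ρ * t < 1) :
    Integrable (fun ω => Real.exp (t * Z ω ^ 2) - 1 - t * Z ω ^ 2) μ :=
  ((h.integrable_exp_mul_sq hZ ht hρt).sub (integrable_const 1)).sub (hZ2.const_mul t)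

/-- The remainder at `t` is compared with the one at `y / (2 ρ)`, where `y = (1 + 2 ρ t) / 2` lies
halfway between `2 ρ t` and the singularity of the moment generating function of `Z²`. -/
theorem integral_exp_mul_sq_sub_one_sub_le (h : HasSubgaussianVectorMGF Z ρ μ) (hZ : Measurable Z)
    (hZ2 : Integrable (fun ω => Z ω ^ 2) μ) (hρ : 0 < ρ) {t : ℝ} (ht : 0 ≤ t)
    (hρt : 2 * ρ * t < 1) :
    ∫ ω, (Real.exp (t * Z ω ^ 2) - 1 - t * Z ω ^ 2) ∂μ ≤
      16 * ρ ^ 2 * t ^ 2 / (2 * (1 - 2 * ρ * t)) := by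
  set a := 2 * ρ * t with ha
  set y := (1 + a) / 2 with hy
  have ha0 : 0 ≤ a := by positivity
  have hapos : 0 < 1 - a := sub_pos.2 hρt
  have hy0 : 0 < y := by positivity
  have hay : a ≤ y := by linarith
  have hscale : 2 * ρ * (y / (2 * ρ)) = y := by field_simp
  have hy1 : 2 * ρ * (y / (2 * ρ)) < 1 := by linarith
  have hIy := h.integrable_exp_mul_sq hZ (by positivity) hy1
  have hpt : ∀ ω, Real.exp (t * Z ω ^ 2) - 1 - t * Z ω ^ 2 ≤
      (a / y) ^ 2 * (Real.exp (y / (2 * ρ) * Z ω ^ 2) - 1) := by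
    intro ω
    have hu : 0 ≤ y / (2 * ρ) * Z ω ^ 2 := by positivity
    rw [show t * Z ω ^ 2 = a / y * (y / (2 * ρ) * Z ω ^ 2) by rw [ha]; field_simp]
    refine (exp_mul_sub_one_sub_le (by positivity) ((div_le_one hy0).2 hay) hu).trans ?_
    exact mul_le_mul_of_nonneg_left (sub_le_self _ hu) (sq_nonneg _)
  calc ∫ ω, (Real.exp (t * Z ω ^ 2) - 1 - t * Z ω ^ 2) ∂μ
      ≤ ∫ ω, (a / y) ^ 2 * (Real.exp (y / (2 * ρ) * Z ω ^ 2) - 1) ∂μ :=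
        integral_mono (h.integrable_exp_mul_sq_sub_one_sub hZ hZ2 ht hρt)
          ((hIy.sub (integrable_const 1)).const_mul _) hpt
    _ = (a / y) ^ 2 * (∫ ω, Real.exp (y / (2 * ρ) * Z ω ^ 2) ∂μ - 1) := by
        rw [integral_const_mul, integral_sub hIy (integrable_const 1)]
        simp
    _ ≤ (a / y) ^ 2 * (ρ * (y / (2 * ρ)) / (1 - 2 * ρ * (y / (2 * ρ)))) := by
        gcongr
        exact h.integral_exp_mul_sq_sub_one_le hZ (by positivity) hy1
    _ = 2 * a ^ 2 / ((1 + a) * (1 - a)) := by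
        rw [hscale, hy, show 1 - (1 + a) / 2 = (1 - a) / 2 by ring]
        field_simp
    _ ≤ 2 * a ^ 2 / (1 * (1 - a)) := by
        gcongr
        linarith
    _ = 16 * ρ ^ 2 * t ^ 2 / (2 * (1 - a)) := by
        rw [ha]
        field_simp
        ring

theorem hasSubgammaMGF_sq_sub_one (h : HasSubgaussianVectorMGF Z ρ μ) (hZ : Measurable Z)
    (hZ2 : Integrable (fun ω => Z ω ^ 2) μ) (hvar : ∫ ω, Z ω ^ 2 ∂μ = 1) (hρ : 0 < ρ) {ε : ℝ}
    (hε : |ε| = 1) :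
    HasSubgammaMGF (fun ω => ε * (Z ω ^ 2 - 1)) (16 * ρ ^ 2) (2 * ρ) μ := by
  intro t ht hρt
  set ψ := 16 * ρ ^ 2 * t ^ 2 / (2 * (1 - 2 * ρ * t))
  set R : Ω → ℝ := fun ω => Real.exp (t * Z ω ^ 2) - 1 - t * Z ω ^ 2 with hR
  have hpt : ∀ ω, Real.exp (t * (ε * (Z ω ^ 2 - 1))) ≤
      Real.exp (-(ε * t)) * (1 + ε * t * Z ω ^ 2 + R ω) := fun ω => by
    have hrem := exp_sub_one_sub_le_exp_abs_sub_one_sub_abs (ε * (t * Z ω ^ 2))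
    rw [abs_mul, hε, one_mul, abs_of_nonneg (by positivity)] at hrem
    rw [show t * (ε * (Z ω ^ 2 - 1)) = -(ε * t) + ε * (t * Z ω ^ 2) by ring, Real.exp_add]
    gcongr
    simp only [hR]
    linarith
  have hI1 : Integrable (fun ω => 1 + ε * t * Z ω ^ 2) μ :=
    (integrable_const _).add (hZ2.const_mul _)
  have hIR : Integrable R μ := h.integrable_exp_mul_sq_sub_one_sub hZ hZ2 ht hρt
  calc ∫⁻ ω, ENNReal.ofReal (Real.exp (t * (ε * (Z ω ^ 2 - 1)))) ∂μ
      ≤ ∫⁻ ω, ENNReal.ofReal (Real.exp (-(ε * t)) * (1 + ε * t * Z ω ^ 2 + R ω)) ∂μ :=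
        lintegral_mono fun ω => ENNReal.ofReal_le_ofReal (hpt ω)
    _ = ENNReal.ofReal (∫ ω, Real.exp (-(ε * t)) * (1 + ε * t * Z ω ^ 2 + R ω) ∂μ) :=
        (ofReal_integral_eq_lintegral_ofReal ((hI1.add hIR).const_mul _)
          (.of_forall fun ω => (Real.exp_pos _).le.trans (hpt ω))).symm
    _ = ENNReal.ofReal (Real.exp (-(ε * t)) * (ε * t + ∫ ω, R ω ∂μ + 1)) := by
        rw [integral_const_mul, integral_add hI1 hIR, integral_add (integrable_const _)
          (hZ2.const_mul _), integral_const_mul, hvar]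
        simp only [integral_const, probReal_univ, one_smul, mul_one]
        ring_nf
    _ ≤ ENNReal.ofReal (Real.exp (-(ε * t)) * Real.exp (ε * t + ψ)) := by
        gcongr
        refine le_trans ?_ (Real.add_one_le_exp _)
        gcongr
        exact h.integral_exp_mul_sq_sub_one_sub_le hZ hZ2 hρ ht hρt
    _ = ENNReal.ofReal (Real.exp ψ) := by rw [← Real.exp_add, neg_add_cancel_left]

theorem measure_pi_abs_sum_sq_sub_one_gt_le (h : HasSubgaussianVectorMGF Z ρ μ) (hZ : Measurable Z)
    (hZ2 : Integrable (fun ω => Z ω ^ 2) μ) (hvar : ∫ ω, Z ω ^ 2 ∂μ = 1) (hρ : 0 < ρ) (n : ℕ)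
    {s : ℝ} (hs : 0 ≤ s) :
    Measure.pi (fun _ : Fin n => μ)
        {z | ρ * (√(32 * n * s) + 2 * s) < |∑ i, (Z (z i) ^ 2 - 1)|} ≤
      ENNReal.ofReal (2 * Real.exp (-s)) := by
  set τ := ρ * (√(32 * n * s) + 2 * s) with hτ
  have hsqrt : √(2 * (n * (16 * ρ ^ 2)) * s) + 2 * ρ * s = τ := by
    rw [show 2 * (n * (16 * ρ ^ 2)) * s = ρ ^ 2 * (32 * n * s) by ring,
      Real.sqrt_mul (by positivity), Real.sqrt_sq hρ.le, hτ]
    ring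
  have hside : ∀ ε : ℝ, |ε| = 1 → Measure.pi (fun _ : Fin n => μ)
      {z | τ < ∑ i, ε * (Z (z i) ^ 2 - 1)} ≤ ENNReal.ofReal (Real.exp (-s)) := fun ε hε => by
    have hsum := (h.hasSubgammaMGF_sq_sub_one hZ hZ2 hvar hρ hε).pi_sum (by fun_prop) n
    simpa only [hsqrt] using
      hsum.measure_gt_le (by fun_prop) (by positivity) (by positivity) hs
  have hsub : {z : Fin n → Ω | τ < |∑ i, (Z (z i) ^ 2 - 1)|} ⊆
      {z | τ < ∑ i, 1 * (Z (z i) ^ 2 - 1)} ∪ {z | τ < ∑ i, -1 * (Z (z i) ^ 2 - 1)} := fun z hz => by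
    simpa only [Set.mem_union, Set.mem_ofPred_eq, one_mul, neg_one_mul, Finset.sum_neg_distrib,
      lt_abs] using hz
  calc _ ≤ _ := (measure_mono hsub).trans (measure_union_le _ _)
    _ ≤ ENNReal.ofReal (Real.exp (-s)) + ENNReal.ofReal (Real.exp (-s)) :=
        add_le_add (hside 1 abs_one) (hside (-1) (by simp))
    _ = _ := by rw [← ENNReal.ofReal_add (by positivity) (by positivity), two_mul]

end HasSubgaussianVectorMGF

end SubgaussianSquare

section Net

open Module Metric

section NormedSpace

variable {E : Type*} [NormedAddCommGroup E] [NormedSpace ℝ E] [FiniteDimensional ℝ E]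

theorem card_le_of_isSeparated {ε : NNReal} (hε : 0 < ε) {s : Finset E}
    (hs : (s : Set E) ⊆ closedBall 0 1) (h : IsSeparated ε (s : Set E)) :
    (s.card : ℝ) ≤ (1 + 2 / ε) ^ finrank ℝ E := by
  borelize E
  let μ : Measure E := Measure.addHaar
  have hr : (0 : ℝ) < ε / 2 := by positivity
  have hR : (0 : ℝ) < 1 + ε / 2 := by positivity
  have hdisj : (s : Set E).PairwiseDisjoint fun c => ball c (ε / 2 : ℝ) := by
    intro c hc d hd hcd
    have hlt : (ε : ENNReal) < edist c d := h hc hd hcd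
    rw [edist_nndist, ENNReal.coe_lt_coe, ← NNReal.coe_lt_coe, coe_nndist] at hlt
    exact ball_disjoint_ball (by linarith)
  have hsub : ⋃ c ∈ s, ball c (ε / 2 : ℝ) ⊆ ball 0 (1 + ε / 2) :=
    Set.iUnion₂_subset fun c hc => ball_subset_ball' (by linarith [mem_closedBall.1 (hs hc)])
  have hvol : (s.card : ENNReal) * ENNReal.ofReal ((ε / 2) ^ finrank ℝ E) * μ (ball 0 1) ≤
      ENNReal.ofReal ((1 + ε / 2) ^ finrank ℝ E) * μ (ball 0 1) :=
    calc _ = μ (⋃ c ∈ s, ball c (ε / 2 : ℝ)) := by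
          rw [measure_biUnion_finset hdisj fun c _ => measurableSet_ball]
          simp only [μ.addHaar_ball_of_pos _ hr, Finset.sum_const, nsmul_eq_mul, mul_assoc]
      _ ≤ μ (ball 0 (1 + ε / 2)) := measure_mono hsub
      _ = _ := μ.addHaar_ball_of_pos _ hR
  have hcard := ENNReal.toReal_le_of_le_ofReal (by positivity) ((ENNReal.mul_le_mul_iff_left
    (measure_ball_pos μ _ zero_lt_one).ne' measure_ball_lt_top.ne).1 hvol)
  rw [ENNReal.toReal_mul, ENNReal.toReal_natCast, ENNReal.toReal_ofReal (by positivity),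
    ← le_div_iff₀ (by positivity), ← div_pow] at hcard
  refine hcard.trans_eq ?_
  field_simp
  ring

theorem exists_finset_isCover_sphere {ε : NNReal} (hε : 0 < ε) :
    ∃ s : Finset E, (s : Set E) ⊆ sphere 0 1 ∧ (s.card : ℝ) ≤ (1 + 2 / ε) ^ finrank ℝ E ∧
      IsCover ε (sphere (0 : E) 1) s := by
  have hpack : packingNumber ε (sphere (0 : E) 1) ≠ ⊤ := by
    obtain ⟨N, -, hNfin, hN⟩ := exists_finite_isCover_of_isCompact (half_pos hε).ne'
      (isCompact_sphere (0 : E) 1)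
    have hle := packingNumber_two_mul_le_externalCoveringNumber (ε / 2) (sphere (0 : E) 1)
    rw [mul_div_cancel₀ _ two_ne_zero] at hle
    exact ne_top_of_le_ne_top (Set.encard_ne_top_iff.2 hNfin)
      (hle.trans hN.externalCoveringNumber_le_encard)
  have hfin : (maximalSeparatedSet ε (sphere (0 : E) 1)).Finite := by
    rwa [← Set.encard_ne_top_iff, encard_maximalSeparatedSet hpack]
  refine ⟨hfin.toFinset, ?_, card_le_of_isSeparated hε ?_ ?_, ?_⟩ <;> rw [hfin.coe_toFinset]
  · exact maximalSeparatedSet_subset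
  · exact maximalSeparatedSet_subset.trans sphere_subset_closedBall
  · exact isSeparated_maximalSeparatedSet
  · exact isCover_maximalSeparatedSet hpack

end NormedSpace

variable {E : Type*} [NormedAddCommGroup E] [InnerProductSpace ℝ E]

theorem norm_le_of_forall_abs_inner_le {T : E →L[ℝ] E} (hT : T.IsSymmetric) {C : ℝ} (hC : 0 ≤ C)
    (h : ∀ x, ‖x‖ = 1 → |inner ℝ x (T x)| ≤ C) : ‖T‖ ≤ C := by
  rw [ContinuousLinearMap.norm_eq_iSup_rayleighQuotient T hT]
  refine ciSup_le fun x => ?_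
  rw [ContinuousLinearMap.rayleighQuotient, ContinuousLinearMap.reApplyInnerSelf_apply]
  rcases eq_or_ne x 0 with rfl | hx
  · simpa using hC
  have hx' : 0 < ‖x‖ := norm_pos_iff.2 hx
  have hunit := h (‖x‖⁻¹ • x) (by rw [norm_smul, norm_inv, norm_norm, inv_mul_cancel₀ hx'.ne'])
  rw [map_smul, real_inner_smul_left, inner_smul_right] at hunit
  convert! hunit using 2
  rw [real_inner_comm, RCLike.re_to_real]
  field_simp

/-- `|⟪x, T x⟫ - ⟪c, T c⟫| ≤ 2 ε ‖T‖` when `‖x - c‖ ≤ ε`, so that the maximum `‖T‖` of `|⟪x, T x⟫|`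
is at most `τ + 2 ε ‖T‖`. -/
theorem norm_le_of_isCover_sphere {T : E →L[ℝ] E} (hT : T.IsSymmetric) {s : Set E}
    (hs : s ⊆ sphere 0 1) {ε : NNReal} (hcover : IsCover ε (sphere 0 1) s) (hε : 2 * (ε : ℝ) < 1)
    {τ : ℝ} (hτ : 0 ≤ τ) (hsmall : ∀ c ∈ s, |inner ℝ c (T c)| ≤ τ) :
    ‖T‖ ≤ τ / (1 - 2 * ε) := by
  have hunit : ∀ x : E, ‖x‖ = 1 → |inner ℝ x (T x)| ≤ τ + 2 * ε * ‖T‖ := by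
    intro x hx
    obtain ⟨c, hc, hxc⟩ := hcover (mem_sphere_zero_iff_norm.2 hx)
    have hdist : ‖x - c‖ ≤ ε := by
      have hle : edist x c ≤ ε := hxc
      rwa [edist_nndist, ENNReal.coe_le_coe, ← NNReal.coe_le_coe, coe_nndist, dist_eq_norm] at hle
    have hc1 : ‖c‖ = 1 := mem_sphere_zero_iff_norm.1 (hs hc)
    have hleft : |inner ℝ (x - c) (T x)| ≤ ε * ‖T‖ := by
      refine (abs_real_inner_le_norm _ _).trans ?_
      gcongr
      simpa [hx] using T.le_opNorm x
    have hright : |inner ℝ c (T (x - c))| ≤ ε * ‖T‖ := by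
      refine (abs_real_inner_le_norm _ _).trans ?_
      rw [hc1, one_mul, mul_comm]
      exact (T.le_opNorm _).trans (by gcongr)
    have hsplit : inner ℝ x (T x) =
        inner ℝ c (T c) + (inner ℝ (x - c) (T x) + inner ℝ c (T (x - c))) := by
      rw [map_sub, inner_sub_left, inner_sub_right]
      ring
    rw [hsplit]
    linarith [abs_add_le (inner ℝ c (T c)) (inner ℝ (x - c) (T x) + inner ℝ c (T (x - c))),
      abs_add_le (inner ℝ (x - c) (T x)) (inner ℝ c (T (x - c))), hsmall c hc]
  have hnorm := norm_le_of_forall_abs_inner_le hT (by positivity) hunit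
  rw [le_div_iff₀ (by linarith)]
  linarith

end Net

section SubgaussianDesign

open InnerProductSpace

variable {E : Type*} [NormedAddCommGroup E] [InnerProductSpace ℝ E] [FiniteDimensional ℝ E]

theorem le_sum_sq_of_isCover_sphere {n : ℕ} {w : Fin n → E} {s : Set E}
    (hs : s ⊆ Metric.sphere 0 1) {ε : NNReal} (hcover : Metric.IsCover ε (Metric.sphere 0 1) s)
    (hε : 2 * (ε : ℝ) < 1) {τ : ℝ} (hτ : 0 ≤ τ)
    (hsmall : ∀ c ∈ s, |∑ i, (inner ℝ c (w i) ^ 2 - 1)| ≤ τ) (v : E) :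
    (n - τ / (1 - 2 * ε)) * ‖v‖ ^ 2 ≤ ∑ i, inner ℝ v (w i) ^ 2 := by
  set T := ∑ i, rankOne ℝ (w i) (w i) - (n : ℝ) • (1 : E →L[ℝ] E)
  have hsymm : T.IsSymmetric := by
    refine (IsSelfAdjoint.sub ?_ ((IsSelfAdjoint.all _).smul (IsSelfAdjoint.one _))).isSymmetric
    exact isSelfAdjoint_sum _ fun i _ => (isPositive_rankOne_self (w i)).isSelfAdjoint
  have hquad : ∀ x, inner ℝ x (T x) = ∑ i, inner ℝ x (w i) ^ 2 - n * ‖x‖ ^ 2 := fun x => by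
    rw [sub_apply, inner_sub_right, inner_sum_rankOne_apply, smul_apply, one_apply_eq_self,
      inner_smul_right, real_inner_self_eq_norm_sq]
  have hnorm : ‖T‖ ≤ τ / (1 - 2 * ε) := by
    refine norm_le_of_isCover_sphere hsymm hs hcover hε hτ fun c hc => ?_
    have hc1 : ‖c‖ = 1 := mem_sphere_zero_iff_norm.1 (hs hc)
    simpa [hquad, hc1] using hsmall c hc
  have hv : |inner ℝ v (T v)| ≤ τ / (1 - 2 * ε) * ‖v‖ ^ 2 :=
    calc |inner ℝ v (T v)| ≤ ‖v‖ * ‖T v‖ := abs_real_inner_le_norm _ _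
      _ ≤ ‖v‖ * (‖T‖ * ‖v‖) := by gcongr; exact T.le_opNorm v
      _ = ‖T‖ * ‖v‖ ^ 2 := by ring
      _ ≤ _ := by gcongr
  rw [hquad] at hv
  linarith [neg_le_of_abs_le hv]

variable [MeasurableSpace E] [BorelSpace E] {ν : Measure E}

theorem IsIsotropic.measure_pi_exists_sum_sq_lt_le_of_subgaussian (hν : IsIsotropic ν)
    [IsProbabilityMeasure ν] {ρ : ℝ} (hsg : HasSubgaussianVectorMGF id ρ ν) (hρ : 0 < ρ) (n : ℕ)
    {s : ℝ} (hs : 0 ≤ s) :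
    Measure.pi (fun _ : Fin n => ν) {w | ∃ v : E, ∑ i, inner ℝ v (w i) ^ 2 <
        (n - 10 * ρ / 9 * (√(32 * n * s) + 2 * s)) * ‖v‖ ^ 2} ≤
      ENNReal.ofReal (41 ^ Module.finrank ℝ E * (2 * Real.exp (-s))) := by
  obtain ⟨N, hN, hcard, hcover⟩ := exists_finset_isCover_sphere (E := E)
    (ε := 1 / 20) (by positivity)
  set τ := ρ * (√(32 * n * s) + 2 * s) with hτ
  have hτ0 : 0 ≤ τ := by positivity
  have hsub : {w : Fin n → E | ∃ v : E, ∑ i, inner ℝ v (w i) ^ 2 <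
        (n - 10 * ρ / 9 * (√(32 * n * s) + 2 * s)) * ‖v‖ ^ 2} ⊆
      ⋃ c ∈ N, {w : Fin n → E | τ < |∑ i, (inner ℝ c (w i) ^ 2 - 1)|} := by
    rintro w ⟨v, hv⟩
    by_contra hcon
    simp only [Set.mem_iUnion, Set.mem_ofPred_eq, not_exists, not_lt] at hcon
    have hle := le_sum_sq_of_isCover_sphere hN hcover (by norm_num) hτ0 hcon v
    refine hv.not_ge (le_trans (le_of_eq ?_) hle)
    rw [hτ]
    push_cast
    ring
  have hpoint : ∀ c ∈ N, Measure.pi (fun _ : Fin n => ν)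
      {w | τ < |∑ i, (inner ℝ c (w i) ^ 2 - 1)|} ≤ ENNReal.ofReal (2 * Real.exp (-s)) := by
    intro c hc
    have hc1 : ‖c‖ = 1 := mem_sphere_zero_iff_norm.1 (hN hc)
    have hproj := hsg.inner_left c
    rw [hc1, one_pow, mul_one] at hproj
    exact hproj.measure_pi_abs_sum_sq_sub_one_gt_le (by fun_prop) (hν.integrable_sq c)
      (by simp [hν.integral_sq, hc1]) hρ n hs
  calc _ ≤ ∑ c ∈ N, Measure.pi (fun _ : Fin n => ν)
          {w | τ < |∑ i, (inner ℝ c (w i) ^ 2 - 1)|} :=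
        (measure_mono hsub).trans (measure_biUnion_finset_le _ _)
    _ ≤ N.card * ENNReal.ofReal (2 * Real.exp (-s)) := by
        simpa using Finset.sum_le_sum hpoint
    _ ≤ ENNReal.ofReal (41 ^ Module.finrank ℝ E * (2 * Real.exp (-s))) := by
        rw [← ENNReal.ofReal_natCast, ← ENNReal.ofReal_mul (by positivity)]
        gcongr
        exact hcard.trans (by norm_num)

end SubgaussianDesign

section GramSchmidt

open InnerProductSpace

variable {E : Type*} [NormedAddCommGroup E] [InnerProductSpace ℝ E]
  {ι : Type*} [LinearOrder ι] [LocallyFiniteOrderBot ι] [WellFoundedLT ι]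

theorem measurable_gramSchmidt [MeasurableSpace E] [BorelSpace E] [SecondCountableTopology E]
    (j : ι) : Measurable fun f : ι → E => gramSchmidt ℝ f j := by
  induction j using WellFoundedLT.induction with
  | ind j ih =>
    simp only [gramSchmidt_def ℝ _ j, Submodule.starProjection_singleton]
    refine (measurable_pi_apply j).sub (Finset.measurable_sum _ fun i hi => ?_)
    have hi' := ih i (Finset.mem_Iio.1 hi)
    exact ((hi'.inner (measurable_pi_apply j)).div (hi'.norm.pow_const 2)).smul hi'

theorem measurable_gramSchmidtNormed [MeasurableSpace E] [BorelSpace E] [SecondCountableTopology E]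
    (j : ι) : Measurable fun f : ι → E => gramSchmidtNormed ℝ f j := by
  have h : Measurable fun f : ι → E => gramSchmidt ℝ f j := measurable_gramSchmidt j
  exact (show Measurable fun f : ι → E => ((‖gramSchmidt ℝ f j‖ : ℝ)⁻¹) by fun_prop).smul h

theorem inner_gramSchmidtNormed_of_ne (f : ι → E) {i j : ι} (hij : i ≠ j) :
    inner ℝ (gramSchmidtNormed ℝ f i) (gramSchmidtNormed ℝ f j) = 0 := by
  simp [gramSchmidtNormed, inner_smul_left, inner_smul_right, gramSchmidt_orthogonal ℝ f hij]

theorem inner_gramSchmidtNormed_self_smul (f : ι → E) (j : ι) :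
    inner ℝ (gramSchmidtNormed ℝ f j) (gramSchmidtNormed ℝ f j) • gramSchmidtNormed ℝ f j =
      gramSchmidtNormed ℝ f j := by
  by_cases h : gramSchmidtNormed ℝ f j = 0
  · simp [h]
  · simp [gramSchmidtNormed_unit_length' h]

theorem inner_gramSchmidtNormed_self_le_one (f : ι → E) (j : ι) :
    inner ℝ (gramSchmidtNormed ℝ f j) (gramSchmidtNormed ℝ f j) ≤ 1 := by
  by_cases h : gramSchmidtNormed ℝ f j = 0
  · simp [h]
  · simp [gramSchmidtNormed_unit_length' h]

variable [Fintype ι]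

theorem norm_sum_smul_gramSchmidtNormed_sq_le (f : ι → E) (b : ι → ℝ) :
    ‖∑ j, b j • gramSchmidtNormed ℝ f j‖ ^ 2 ≤ ∑ j, b j ^ 2 := by
  rw [← real_inner_self_eq_norm_sq, sum_inner]
  refine Finset.sum_le_sum fun j _ => ?_
  rw [inner_sum, Finset.sum_eq_single j (fun i _ hij => by
    simp [inner_smul_left, inner_smul_right, inner_gramSchmidtNormed_of_ne f hij.symm]) (by simp),
    real_inner_smul_left, real_inner_smul_right]
  nlinarith [sq_nonneg (b j), inner_gramSchmidtNormed_self_le_one f j]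

theorem sum_inner_gramSchmidtNormed_smul {f : ι → E} {u : E}
    (hu : u ∈ Submodule.span ℝ (Set.range f)) :
    ∑ j, inner ℝ (gramSchmidtNormed ℝ f j) u • gramSchmidtNormed ℝ f j = u := by
  rw [← span_gramSchmidt ℝ f, ← span_gramSchmidtNormed_range] at hu
  induction hu using Submodule.span_induction with
  | mem u hu =>
    obtain ⟨k, rfl⟩ := hu
    rw [Finset.sum_eq_single k (fun j _ hjk => by rw [inner_gramSchmidtNormed_of_ne f hjk,
      zero_smul]) (by simp), inner_gramSchmidtNormed_self_smul]
  | zero => simp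
  | add u v _ _ hu hv => simp only [inner_add_right, add_smul, Finset.sum_add_distrib, hu, hv]
  | smul a u _ hu => simp only [inner_smul_right, mul_smul, ← Finset.smul_sum, hu]

theorem norm_sq_le_sum_inner_gramSchmidtNormed_sq {f : ι → E} {u r : E}
    (hu : u ∈ Submodule.span ℝ (Set.range f)) (hur : inner ℝ u r = ‖u‖ ^ 2) :
    ‖u‖ ^ 2 ≤ ∑ j, inner ℝ (gramSchmidtNormed ℝ f j) r ^ 2 := by
  have inner_eq : ∀ x : E, inner ℝ u x =
      ∑ j, inner ℝ (gramSchmidtNormed ℝ f j) u * inner ℝ (gramSchmidtNormed ℝ f j) x := fun x => by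
    conv_lhs => rw [← sum_inner_gramSchmidtNormed_smul hu]
    simp only [sum_inner, real_inner_smul_left]
  have h1 := inner_eq u
  have h2 := inner_eq r
  rw [real_inner_self_eq_norm_sq] at h1
  have h3 : 0 ≤ ∑ j, (inner ℝ (gramSchmidtNormed ℝ f j) u -
      inner ℝ (gramSchmidtNormed ℝ f j) r) ^ 2 := Finset.sum_nonneg fun j _ => sq_nonneg _
  simp only [sub_sq, Finset.sum_add_distrib, Finset.sum_sub_distrib, mul_assoc,
    ← Finset.mul_sum, ← h2] at h3
  simp only [sq] at h1 h3 hur ⊢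
  linarith

end GramSchmidt

section ConditionalSubgaussian

open InnerProductSpace
open scoped NNReal ENNReal

theorem hasSubgaussianMGF_condDistrib {Ω α : Type*} [MeasurableSpace Ω] [mα : MeasurableSpace α]
    {P : Measure Ω} [IsFiniteMeasure P] {X : Ω → α} {R : Ω → ℝ} {c : ℝ≥0} (hX : Measurable X)
    (hR : Measurable R) (hint : ∀ t : ℝ, Integrable (fun ω => Real.exp (t * R ω)) P)
    (hle : ∀ t : ℝ, ∀ᵐ ω ∂P, (P[fun ω => Real.exp (t * R ω) | mα.comap X]) ω ≤
      Real.exp (c * t ^ 2 / 2)) :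
    Kernel.HasSubgaussianMGF id c (condDistrib R X P) (P.map X) := by
  refine Kernel.HasSubgaussianMGF.of_rat (fun t => ?_) fun q => ?_
  · rw [condDistrib_comp_map hX.aemeasurable hR.aemeasurable,
      integrable_map_measure (by fun_prop) hR.aemeasurable]
    exact hint t
  · rw [ae_map_iff hX.aemeasurable (measurableSet_le ?_ measurable_const)]
    · filter_upwards [hle q, condExp_ae_eq_integral_condDistrib hX hR.aemeasurable
        (f := fun r => Real.exp (q * r)) (by fun_prop) (hint q)] with ω h1 h2
      exact h2.symm.trans_le h1
    · exact (StronglyMeasurable.integral_kernel (by fun_prop)).measurable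

variable {α : Type*} [MeasurableSpace α] {ρ : Measure α} [SFinite ρ]
  {κ : Kernel α ℝ} [IsMarkovKernel κ] {c : ℝ≥0}

theorem lintegral_compProd_mul_exp_le (h : Kernel.HasSubgaussianMGF id c κ ρ) {F : α → ℝ≥0∞}
    {q : α → ℝ} (hF : Measurable F) (hq : Measurable q) :
    ∫⁻ z, F z.1 * ENNReal.ofReal (Real.exp (q z.1 * z.2)) ∂(ρ ⊗ₘ κ) ≤
      ∫⁻ z, F z.1 * ENNReal.ofReal (Real.exp (c * q z.1 ^ 2 / 2)) ∂(ρ ⊗ₘ κ) := by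
  rw [Measure.lintegral_compProd (by fun_prop), Measure.lintegral_compProd (by fun_prop)]
  refine lintegral_mono_ae ?_
  filter_upwards [h.mgf_le, h.ae_forall_integrable_exp_mul] with x hmgf hint
  rw [lintegral_const_mul _ (by fun_prop), lintegral_const, measure_univ, mul_one,
    ← ofReal_integral_eq_lintegral_ofReal (f := fun r => Real.exp (q x * r)) (hint (q x))
      (ae_of_all _ fun r => (Real.exp_pos _).le)]
  gcongr
  exact hmgf (q x)

theorem fst_comp_update {ι α β : Type*} [DecidableEq ι] (z : ι → α × β) (j : ι) (w : α × β) :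
    (fun i => (Function.update z j w i).1) = Function.update (fun i => (z i).1) j w.1 :=
  Function.comp_update Prod.fst z j w

variable {ι : Type*} [Fintype ι]

theorem lintegral_pi_mul_exp_coord_le [IsProbabilityMeasure ρ] [DecidableEq ι]
    (h : Kernel.HasSubgaussianMGF id c κ ρ)
    {G : (ι → α × ℝ) → ℝ≥0∞} {q : (ι → α) → ℝ} (hG : Measurable G) (hq : Measurable q) (j : ι)
    (hGj : ∀ z x r, G (Function.update z j (x, r)) = G (Function.update z j (x, 0))) :
    ∫⁻ z, G z * ENNReal.ofReal (Real.exp (q (fun i => (z i).1) * (z j).2))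
        ∂Measure.pi (fun _ => ρ ⊗ₘ κ) ≤
      ∫⁻ z, G z * ENNReal.ofReal (Real.exp (c * q (fun i => (z i).1) ^ 2 / 2))
        ∂Measure.pi (fun _ => ρ ⊗ₘ κ) := by
  refine lintegral_le_of_lmarginal_le {j} (by fun_prop) (by fun_prop) fun z => ?_
  simp only [lmarginal_singleton, fst_comp_update, Function.update_self]
  have hG' : ∀ w : α × ℝ, G (Function.update z j w) = G (Function.update z j (w.1, 0)) :=
    fun w => hGj z w.1 w.2
  simp only [hG']
  exact lintegral_compProd_mul_exp_le h
    (F := fun x => G (Function.update z j (x, 0)))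
    (q := fun x => q (Function.update (fun i => (z i).1) j x))
    (hG.comp ((measurable_update z).comp (by fun_prop)))
    (hq.comp (measurable_update _))

theorem lintegral_pi_exp_sum_le_compl [IsProbabilityMeasure ρ] [DecidableEq ι]
    (h : Kernel.HasSubgaussianMGF id c κ ρ) {q : ι → (ι → α) → ℝ} (hq : ∀ i, Measurable (q i))
    (s : Finset ι) :
    ∫⁻ z, ENNReal.ofReal (Real.exp (∑ i, q i (fun j => (z j).1) * (z i).2))
        ∂Measure.pi (fun _ => ρ ⊗ₘ κ) ≤
      ∫⁻ z, ENNReal.ofReal (Real.exp (∑ i ∈ sᶜ, q i (fun j => (z j).1) * (z i).2)) *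
        ENNReal.ofReal (Real.exp (∑ i ∈ s, c * q i (fun j => (z j).1) ^ 2 / 2))
        ∂Measure.pi (fun _ => ρ ⊗ₘ κ) := by
  induction s using Finset.induction_on with
  | empty => simp
  | insert j s hj ih =>
    refine ih.trans ?_
    simp only [← Finset.add_sum_erase _ _ (Finset.mem_compl.2 hj), Finset.sum_insert hj,
      Finset.compl_insert, Real.exp_add, ENNReal.ofReal_mul (Real.exp_pos _).le]
    have hstep := lintegral_pi_mul_exp_coord_le h (q := q j) (G := fun z =>
      ENNReal.ofReal (Real.exp (∑ i ∈ sᶜ.erase j, q i (fun j => (z j).1) * (z i).2)) *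
        ENNReal.ofReal (Real.exp (∑ i ∈ s, c * q i (fun j => (z j).1) ^ 2 / 2)))
      (by fun_prop) (hq j) j fun z x r => by
        have sum_update : ∀ (q : ι → ℝ) (r : ℝ),
            ∑ i ∈ sᶜ.erase j, q i * (Function.update z j (x, r) i).2 =
              ∑ i ∈ sᶜ.erase j, q i * (z i).2 := fun q r => Finset.sum_congr rfl fun i hi => by
          rw [Function.update_of_ne (Finset.ne_of_mem_erase hi)]
        simp only [fst_comp_update, sum_update]
    calc _ = _ := lintegral_congr fun z => by ring
      _ ≤ _ := hstep
      _ = _ := lintegral_congr fun z => by ring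

theorem lintegral_pi_exp_sum_le [IsProbabilityMeasure ρ] (h : Kernel.HasSubgaussianMGF id c κ ρ)
    {q : ι → (ι → α) → ℝ} (hq : ∀ i, Measurable (q i)) :
    ∫⁻ z, ENNReal.ofReal (Real.exp (∑ i, q i (fun j => (z j).1) * (z i).2))
        ∂Measure.pi (fun _ => ρ ⊗ₘ κ) ≤
      ∫⁻ z, ENNReal.ofReal (Real.exp (∑ i, c * q i (fun j => (z j).1) ^ 2 / 2))
        ∂Measure.pi (fun _ => ρ ⊗ₘ κ) := by
  classical simpa using lintegral_pi_exp_sum_le_compl h hq Finset.univ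

theorem hasSubgaussianVectorMGF_sum_smul {E : Type*} [NormedAddCommGroup E]
    [InnerProductSpace ℝ E] [MeasurableSpace E] [BorelSpace E] [SecondCountableTopology E]
    [IsProbabilityMeasure ρ] (h : Kernel.HasSubgaussianMGF id c κ ρ)
    {w : ι → (ι → α) → E} (hw : ∀ i, Measurable (w i))
    (hle : ∀ x b, ∑ i, inner ℝ b (w i x) ^ 2 ≤ ‖b‖ ^ 2) :
    HasSubgaussianVectorMGF (fun z : ι → α × ℝ => ∑ i, (z i).2 • w i fun j => (z j).1) c
      (Measure.pi fun _ => ρ ⊗ₘ κ) := by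
  intro b
  calc ∫⁻ z, ENNReal.ofReal (Real.exp (inner ℝ b (∑ i, (z i).2 • w i fun j => (z j).1)))
        ∂Measure.pi (fun _ : ι => ρ ⊗ₘ κ)
      = ∫⁻ z, ENNReal.ofReal (Real.exp (∑ i, inner ℝ b (w i fun j => (z j).1) * (z i).2))
        ∂Measure.pi (fun _ => ρ ⊗ₘ κ) := by
        simp only [inner_sum, real_inner_smul_right, mul_comm]
    _ ≤ ∫⁻ z, ENNReal.ofReal (Real.exp (∑ i, c * inner ℝ b (w i fun j => (z j).1) ^ 2 / 2))
        ∂Measure.pi (fun _ => ρ ⊗ₘ κ) :=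
        lintegral_pi_exp_sum_le h (q := fun i x => inner ℝ b (w i x))
          fun i => measurable_const.inner (hw i)
    _ ≤ ∫⁻ _, ENNReal.ofReal (Real.exp (c * ‖b‖ ^ 2 / 2))
        ∂Measure.pi (fun _ : ι => ρ ⊗ₘ κ) := by
        gcongr
        rw [← Finset.sum_div, ← Finset.mul_sum]
        gcongr
        exact hle _ b
    _ = ENNReal.ofReal (Real.exp (c * ‖b‖ ^ 2 / 2)) := by simp

theorem measure_pi_sum_inner_gramSchmidtNormed_sq_gt_le [IsProbabilityMeasure ρ]
    (h : Kernel.HasSubgaussianMGF id c κ ρ) {d : ℕ}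
    {f : (ι → α) → Fin d → EuclideanSpace ℝ ι} (hf : Measurable f) {s : ℝ} (hs : 0 ≤ s) :
    Measure.pi (fun _ => ρ ⊗ₘ κ) {z : ι → α × ℝ | c * (d + 2 * √(d * s) + 2 * s) <
      ∑ j, inner ℝ (gramSchmidtNormed ℝ (f fun i => (z i).1) j)
        (WithLp.toLp 2 fun i => (z i).2) ^ 2} ≤ ENNReal.ofReal (Real.exp (-s)) := by
  set w : ι → (ι → α) → EuclideanSpace ℝ (Fin d) := fun i x =>
    WithLp.toLp 2 fun j => gramSchmidtNormed ℝ (f x) j i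
  have hw : ∀ i, Measurable (w i) := fun i => by
    have : ∀ j, Measurable fun x => gramSchmidtNormed ℝ (f x) j := fun j =>
      (measurable_gramSchmidtNormed j).comp hf
    fun_prop
  have hle : ∀ x b, ∑ i, inner ℝ b (w i x) ^ 2 ≤ ‖b‖ ^ 2 := fun x b => by
    have := norm_sum_smul_gramSchmidtNormed_sq_le (f x) b
    simpa [EuclideanSpace.norm_sq_eq, PiLp.inner_apply, w, mul_comm] using this
  have hS := (hasSubgaussianVectorMGF_sum_smul h hw hle).measure_norm_sq_gt_le
    (by fun_prop) c.2 hs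
  rw [finrank_euclideanSpace_fin] at hS
  refine le_of_eq_of_le ?_ hS
  congr with z
  simp [EuclideanSpace.norm_sq_eq, PiLp.inner_apply, w, mul_comm]

end ConditionalSubgaussian

section QuadraticForm

variable {d : ℕ} {A B S T : Mat d}

theorem app_mul (A B : Mat d) (v : Vec d) : app (A * B) v = app A (app B v) := by
  simp only [app, map_mul, mul_apply_eq_comp]

theorem app_app_inv (hA : IsUnit A.det) (v : Vec d) : app A (app A⁻¹ v) = v := by
  rw [← app_mul, Matrix.mul_nonsing_inv A hA, app, map_one, one_apply_eq_self]

theorem inner_app_eq_dotProduct (A : Mat d) (v w : Vec d) :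
    inner ℝ v (app A w) = v.ofLp ⬝ᵥ A *ᵥ w.ofLp :=
  Matrix.inner_toEuclideanCLM A v w

theorem inner_app_left (hA : A.IsHermitian) (v w : Vec d) :
    inner ℝ (app A v) w = inner ℝ v (app A w) := by
  rw [real_inner_comm, inner_app_eq_dotProduct, inner_app_eq_dotProduct, Matrix.dotProduct_mulVec,
    ← Matrix.mulVec_transpose, ← Matrix.conjTranspose_eq_transpose_of_trivial, hA.eq,
    dotProduct_comm]

theorem posSemidef_iff_inner_app_nonneg (hA : A.IsHermitian) :
    A.PosSemidef ↔ ∀ v : Vec d, 0 ≤ inner ℝ v (app A v) := by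
  simp only [Matrix.posSemidef_iff_dotProduct_mulVec, hA, true_and, star_trivial,
    inner_app_eq_dotProduct]
  exact (WithLp.equiv 2 (Fin d → ℝ)).symm.forall_congr_left

theorem smul_le_iff_inner_app_le (hS : S.IsHermitian) (hT : T.IsHermitian) (c : ℝ) :
    c • S ≤ T ↔ ∀ v : Vec d, c * inner ℝ v (app S v) ≤ inner ℝ v (app T v) := by
  have hTS : (T - c • S).IsHermitian := hT.sub (hS.smul (IsSelfAdjoint.all c))
  rw [Matrix.le_iff, posSemidef_iff_inner_app_nonneg hTS]
  simp only [app, map_sub, map_smul, sub_apply, smul_apply,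
    inner_sub_right, inner_smul_right, sub_nonneg]

theorem mNorm_sq (hS : S.PosSemidef) (v : Vec d) : mNorm S v ^ 2 = inner ℝ v (app S v) :=
  Real.sq_sqrt ((posSemidef_iff_inner_app_nonneg hS.isHermitian).1 hS v)

theorem posDef_sqrtM (hS : S.PosDef) : (sqrtM S).PosDef :=
  Matrix.isStrictlyPositive_iff_posDef.1 (IsStrictlyPositive.sqrt S hS.isStrictlyPositive)

theorem norm_app_sqrtM_sq (hS : S.PosSemidef) (v : Vec d) :
    ‖app (sqrtM S) v‖ ^ 2 = inner ℝ v (app S v) := by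
  have hR : (sqrtM S).PosSemidef := Matrix.nonneg_iff_posSemidef.1 (CFC.sqrt_nonneg S)
  rw [← real_inner_self_eq_norm_sq, inner_app_left hR.isHermitian, ← app_mul, sqrtM,
    CFC.sqrt_mul_sqrt_self S hS.nonneg]

theorem inner_app_sqrtM_inv (hS : S.PosDef) (v w : Vec d) :
    inner ℝ (app (sqrtM S) v) (app (sqrtM S)⁻¹ w) = inner ℝ v w := by
  have hR := posDef_sqrtM hS
  rw [inner_app_left hR.isHermitian, app_app_inv hR.det_pos.ne'.isUnit]

theorem posDef_of_smul_le {c : ℝ} (hc : 0 < c) (hS : S.PosDef) (hST : c • S ≤ T) : T.PosDef := by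
  simpa only [add_sub_cancel] using (hS.smul hc).add_posSemidef (Matrix.le_iff.1 hST)

theorem mNorm_sq_le_mul_mNorm_sq {K : ℝ} (hK : 0 < K) (hS : S.PosSemidef) (hT : T.PosSemidef)
    (hST : K⁻¹ • S ≤ T) (v : Vec d) : mNorm S v ^ 2 ≤ K * mNorm T v ^ 2 := by
  rw [mNorm_sq hS, mNorm_sq hT, ← inv_mul_le_iff₀ hK]
  exact (smul_le_iff_inner_app_le hS.isHermitian hT.isHermitian _).1 hST v

theorem specNorm_sqrtM_mul_inv_mul_sqrtM_le {K : ℝ} (hK : 0 < K) (hS : S.PosDef)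
    (hST : K⁻¹ • S ≤ T) : specNorm (sqrtM S * T⁻¹ * sqrtM S) ≤ K := by
  have hT : T.PosDef := posDef_of_smul_le (inv_pos.2 hK) hS hST
  refine ContinuousLinearMap.opNorm_le_bound _ hK.le fun u => ?_
  change ‖app (sqrtM S * T⁻¹ * sqrtM S) u‖ ≤ _
  rw [app_mul, app_mul]
  set v := app T⁻¹ (app (sqrtM S) u) with hv
  have hquad : ‖app (sqrtM S) v‖ ^ 2 ≤ K * inner ℝ (app (sqrtM S) v) u := by
    rw [norm_app_sqrtM_sq hS.posSemidef, ← inv_mul_le_iff₀ hK,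
      inner_app_left (posDef_sqrtM hS).isHermitian]
    refine ((smul_le_iff_inner_app_le hS.isHermitian hT.isHermitian _).1 hST v).trans_eq ?_
    rw [hv, app_app_inv hT.det_pos.ne'.isUnit]
  rcases (norm_nonneg (app (sqrtM S) v)).eq_or_lt with hzero | hpos
  · rw [← hzero]
    positivity
  · refine le_of_mul_le_mul_left ?_ hpos
    calc ‖app (sqrtM S) v‖ * ‖app (sqrtM S) v‖ = ‖app (sqrtM S) v‖ ^ 2 := (sq _).symm
      _ ≤ K * (‖app (sqrtM S) v‖ * ‖u‖) :=
          hquad.trans (mul_le_mul_of_nonneg_left (real_inner_le_norm _ _) hK.le)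
      _ = ‖app (sqrtM S) v‖ * (K * ‖u‖) := by ring

end QuadraticForm

section LeastSquares

open InnerProductSpace

variable {d n : ℕ}

theorem app_empSecondMoment (x : Fin n → Vec d) (v : Vec d) :
    app (empSecondMoment x) v = (n : ℝ)⁻¹ • ∑ k, inner ℝ (x k) v • x k := by
  ext i
  simp only [app, Matrix.ofLp_toEuclideanCLM, Matrix.mulVec, dotProduct, empSecondMoment,
    Matrix.of_apply, PiLp.smul_apply, WithLp.ofLp_sum, Finset.sum_apply, PiLp.inner_apply,
    RCLike.inner_apply, conj_trivial, smul_eq_mul, Finset.sum_mul, Finset.mul_sum, Finset.sum_div]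
  rw [Finset.sum_comm]
  exact Finset.sum_congr rfl fun k _ => Finset.sum_congr rfl fun j _ => by ring

theorem inner_app_empSecondMoment (x : Fin n → Vec d) (v : Vec d) :
    inner ℝ v (app (empSecondMoment x) v) = (n : ℝ)⁻¹ * ∑ k, inner ℝ v (x k) ^ 2 := by
  simp only [app_empSecondMoment, inner_smul_right, inner_sum, real_inner_comm v, sq]

theorem posSemidef_empSecondMoment (x : Fin n → Vec d) : (empSecondMoment x).PosSemidef := by
  refine (posSemidef_iff_inner_app_nonneg ?_).2 fun v => ?_
  · ext i j
    simp only [empSecondMoment, Matrix.conjTranspose_apply, Matrix.of_apply, star_trivial, mul_comm]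
  · rw [inner_app_empSecondMoment]
    positivity

theorem app_empSecondMoment_ols_sub {x : Fin n → Vec d} (hx : IsUnit (empSecondMoment x).det)
    (y : Fin n → ℝ) (β : Vec d) :
    app (empSecondMoment x) (ols x y - β) =
      (n : ℝ)⁻¹ • ∑ k, (y k - inner ℝ (x k) β) • x k := by
  have hols : app (empSecondMoment x) (ols x y) = (n : ℝ)⁻¹ • ∑ k, y k • x k :=
    app_app_inv hx _
  rw [app, map_sub, ← app, ← app, hols, app_empSecondMoment]
  simp only [sub_smul, Finset.sum_sub_distrib, smul_sub]

/-- The `j`-th column of the design matrix whose rows are the covariates `x i`. -/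
def designColumn (x : Fin n → Vec d) (j : Fin d) : EuclideanSpace ℝ (Fin n) :=
  WithLp.toLp 2 fun i => x i j

theorem toLp_inner_eq_sum_smul_designColumn (x : Fin n → Vec d) (v : Vec d) :
    WithLp.toLp 2 (fun i => inner ℝ v (x i)) = ∑ j, v j • designColumn x j := by
  ext i
  simp only [designColumn, PiLp.inner_apply, RCLike.inner_apply, conj_trivial, WithLp.ofLp_sum,
    Finset.sum_apply, PiLp.smul_apply, smul_eq_mul, mul_comm]

theorem mNorm_empSecondMoment_ols_sub_sq_le {x : Fin n → Vec d}
    (hx : IsUnit (empSecondMoment x).det) (y : Fin n → ℝ) (β : Vec d) :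
    mNorm (empSecondMoment x) (ols x y - β) ^ 2 ≤
      (n : ℝ)⁻¹ * ∑ j, inner ℝ (gramSchmidtNormed ℝ (designColumn x) j)
        (WithLp.toLp 2 fun i => y i - inner ℝ (x i) β) ^ 2 := by
  set h := ols x y - β with hh
  set u : EuclideanSpace ℝ (Fin n) := WithLp.toLp 2 fun i => inner ℝ h (x i) with hu
  set r : EuclideanSpace ℝ (Fin n) := WithLp.toLp 2 fun i => y i - inner ℝ (x i) β with hr
  have hspan : u ∈ Submodule.span ℝ (Set.range (designColumn x)) := by
    rw [hu, toLp_inner_eq_sum_smul_designColumn]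
    exact Submodule.sum_mem _ fun j _ => Submodule.smul_mem _ _ (Submodule.subset_span ⟨j, rfl⟩)
  have hnorm : mNorm (empSecondMoment x) h ^ 2 = (n : ℝ)⁻¹ * ‖u‖ ^ 2 := by
    rw [mNorm_sq (posSemidef_empSecondMoment x), inner_app_empSecondMoment,
      EuclideanSpace.real_norm_sq_eq]
  have hnormal : mNorm (empSecondMoment x) h ^ 2 = (n : ℝ)⁻¹ * inner ℝ u r := by
    rw [mNorm_sq (posSemidef_empSecondMoment x), hh, app_empSecondMoment_ols_sub hx]
    simp only [inner_smul_right, inner_sum, PiLp.inner_apply, RCLike.inner_apply, conj_trivial,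
      hu, hr, hh]
  rw [hnorm]
  rcases n.eq_zero_or_pos with rfl | hn
  · simp
  have hn' : (n : ℝ)⁻¹ ≠ 0 := by positivity
  exact mul_le_mul_of_nonneg_left (norm_sq_le_sum_inner_gramSchmidtNormed_sq hspan
    (mul_left_cancel₀ hn' (hnormal.symm.trans hnorm))) (by positivity)

end LeastSquares

section Population

variable {Ω : Type*} [MeasurableSpace Ω] {P : Measure Ω} {d : ℕ} {X : Ω → Vec d}

theorem inner_app_secondMoment (hX : MemLp X 2 P) (v : Vec d) :
    inner ℝ v (app (secondMoment P X) v) = ∫ ω, inner ℝ v (X ω) ^ 2 ∂P := by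
  have hint (i j) : Integrable (fun ω => v i * v j * (X ω i * X ω j)) P :=
    ((hX.eval_piLp i).integrable_mul (hX.eval_piLp j)).const_mul _
  have hsq (ω) : inner ℝ v (X ω) ^ 2 = ∑ i, ∑ j, v i * v j * (X ω i * X ω j) := by
    simp only [sq, PiLp.inner_apply, RCLike.inner_apply, conj_trivial, Finset.sum_mul_sum]
    exact Finset.sum_congr rfl fun i _ => Finset.sum_congr rfl fun j _ => by ring
  simp only [hsq]
  rw [inner_app_eq_dotProduct,
    integral_finsetSum _ fun i _ => integrable_finsetSum _ fun j _ => hint i j]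
  simp only [integral_finsetSum _ fun j _ => hint _ j, integral_const_mul, dotProduct,
    Matrix.mulVec, secondMoment, Matrix.of_apply, Finset.mul_sum]
  exact Finset.sum_congr rfl fun i _ => Finset.sum_congr rfl fun j _ => by ring

theorem posDef_secondMoment (hX : MemLp X 2 P) (hS : IsUnit (secondMoment P X).det) :
    (secondMoment P X).PosDef := by
  have hherm : (secondMoment P X).IsHermitian := by
    ext i j
    simp only [secondMoment, Matrix.conjTranspose_apply, Matrix.of_apply, star_trivial, mul_comm]
  have hpos : (secondMoment P X).PosSemidef :=
    (posSemidef_iff_inner_app_nonneg hherm).2 fun v => by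
      rw [inner_app_secondMoment hX]
      positivity
  exact hpos.posDef_iff_isUnit.2 ((Matrix.isUnit_iff_isUnit_det _).2 hS)

theorem measurable_app (A : Mat d) : Measurable (app A) :=
  (Matrix.toEuclideanCLM (n := Fin d) (𝕜 := ℝ) A).continuous.measurable

theorem measurable_whitened (hXm : Measurable X) : Measurable (whitened P X) :=
  (measurable_app _).comp hXm

/-- The law of the whitened covariate `Σ^{-1/2} X`. -/
def whitenedLaw (P : Measure Ω) (X : Ω → Vec d) : Measure (Vec d) := P.map (whitened P X)

theorem isProbabilityMeasure_whitenedLaw [IsProbabilityMeasure P] (hXm : Measurable X) :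
    IsProbabilityMeasure (whitenedLaw P X) :=
  Measure.isProbabilityMeasure_map (measurable_whitened hXm).aemeasurable

theorem isIsotropic_whitenedLaw (hXm : Measurable X) (hX : MemLp X 2 P)
    (hS : (secondMoment P X).PosDef) : IsIsotropic (whitenedLaw P X) := by
  have hR := posDef_sqrtM hS
  have hm := measurable_whitened (P := P) hXm
  have hinner (v : Vec d) (ω : Ω) : inner ℝ v (whitened P X ω) =
      inner ℝ (app (sqrtM (secondMoment P X))⁻¹ v) (X ω) :=
    (inner_app_left hR.isHermitian.inv v (X ω)).symm
  have hsm (v : Vec d) : AEStronglyMeasurable (fun w : Vec d => inner ℝ v w ^ 2)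
      (P.map (whitened P X)) := by fun_prop
  refine ⟨fun v => ?_, fun v => ?_⟩
  · rw [whitenedLaw, integrable_map_measure (hsm v) hm.aemeasurable]
    simp only [Function.comp_def, hinner]
    exact (hX.const_inner _).integrable_sq
  · rw [whitenedLaw, integral_map hm.aemeasurable (hsm v)]
    simp only [hinner]
    rw [← inner_app_secondMoment hX, ← norm_app_sqrtM_sq hS.posSemidef,
      app_app_inv hR.det_pos.ne'.isUnit]

theorem hasSubgaussianVectorMGF_whitenedLaw (hXm : Measurable X) {ρ : ℝ}
    (h : SubgaussianProjections P X ρ) : HasSubgaussianVectorMGF id ρ (whitenedLaw P X) := by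
  intro b
  rw [whitenedLaw, lintegral_map (by fun_prop) (measurable_whitened hXm)]
  simp only [id_eq]
  rw [← ofReal_integral_eq_lintegral_ofReal (h.2 b).1 (ae_of_all _ fun _ => (Real.exp_pos _).le)]
  exact ENNReal.ofReal_le_ofReal (h.2 b).2

theorem norm_sq_le_of_boundedLeverage (hXm : Measurable X) {ρ : ℝ} (h : BoundedLeverage P X ρ) :
    ∀ᵐ w ∂whitenedLaw P X, ‖w‖ ^ 2 ≤ ρ ^ 2 * d := by
  rcases d.eq_zero_or_pos with rfl | hd
  · exact ae_of_all _ fun w => by simp [Subsingleton.elim w 0]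
  rw [whitenedLaw, ae_map_iff (measurable_whitened hXm).aemeasurable
    (measurableSet_le (by fun_prop) measurable_const)]
  filter_upwards [h.2] with ω hω
  rw [div_le_iff₀ (by positivity)] at hω
  calc ‖whitened P X ω‖ ^ 2 ≤ (ρ * √d) ^ 2 := by gcongr
    _ = ρ ^ 2 * d := by rw [mul_pow, Real.sq_sqrt d.cast_nonneg]

theorem hasSubgaussianMGF_condDistrib_residual [IsProbabilityMeasure P] {Y : Ω → ℝ}
    (hXm : Measurable X) (hYm : Measurable Y) {σ : ℝ} (hnoise : SubgaussianNoise P X Y σ)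
    (hmodel : ∀ᵐ ω ∂P, bias P X Y ω = 0) :
    Kernel.HasSubgaussianMGF id (‖σ‖₊ ^ 2)
      (condDistrib (fun ω => Y ω - inner ℝ (X ω) (betaStar P X Y)) X P) (P.map X) := by
  have hexp (t : ℝ) : (fun ω => Real.exp (t * noise P X Y ω)) =ᵐ[P]
      fun ω => Real.exp (t * (Y ω - inner ℝ (X ω) (betaStar P X Y))) := by
    filter_upwards [hmodel] with ω hω
    rw [noise, sub_eq_zero.1 hω]
  refine hasSubgaussianMGF_condDistrib hXm (by fun_prop)
    (fun t => (hnoise.2 t).1.congr (hexp t)) fun t => ?_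
  filter_upwards [(hnoise.2 t).2, condExp_congr_ae (hexp t)] with ω hle hω
  rw [← hω]
  refine hle.trans_eq ?_
  rw [NNReal.coe_pow, coe_nnnorm, Real.norm_eq_abs, sq_abs, mul_comm (t ^ 2)]

end Population

section Sampling

open InnerProductSpace

variable {Ω₀ Ω : Type*} [MeasurableSpace Ω₀] [MeasurableSpace Ω] {P : Measure Ω₀} {μ : Measure Ω}
  [IsProbabilityMeasure μ] {n : ℕ}

theorem one_sub_add_le_measureReal {A B G : Set Ω} (hG : (A ∪ B)ᶜ ⊆ G) {a b : ℝ} (ha : 0 ≤ a)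
    (hb : 0 ≤ b) (hA : μ A ≤ ENNReal.ofReal a) (hB : μ B ≤ ENNReal.ofReal b) :
    1 - (a + b) ≤ μ.real G := by
  have hA' : μ.real A ≤ a := ENNReal.toReal_le_of_le_ofReal ha hA
  have hB' : μ.real B ≤ b := ENNReal.toReal_le_of_le_ofReal hb hB
  have hcover : G ∪ (A ∪ B) = Set.univ := by rwa [Set.union_comm, ← Set.compl_subset_iff_union]
  have hunion := (measureReal_union_le (μ := μ) G (A ∪ B)).trans
    (add_le_add_right (measureReal_union_le A B) _)
  rw [hcover, probReal_univ] at hunion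
  linarith

theorem measure_sample_mem_le {α : Type*} [MeasurableSpace α] {Z : Fin n → Ω → α} {Z₀ : Ω₀ → α}
    (hcopy : ∀ i, IdentDistrib (Z i) Z₀ μ P) (hindep : iIndepFun Z μ) (B : Set (Fin n → α)) :
    μ {ω | (fun i => Z i ω) ∈ B} ≤ Measure.pi (fun _ : Fin n => P.map Z₀) B := by
  have hm (i) : AEMeasurable (Z i) μ := (hcopy i).aemeasurable_fst
  have hlaw := (iIndepFun_iff_map_fun_eq_pi_map hm).1 hindep
  simp only [fun i => (hcopy i).map_eq] at hlaw
  rw [← hlaw]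
  exact Measure.le_map_apply (aemeasurable_pi_lambda _ hm) B

variable {d : ℕ} {X : Ω₀ → Vec d} {Y : Ω₀ → ℝ} {Xs : Fin n → Ω → Vec d} {Ys : Fin n → Ω → ℝ}

theorem measure_not_smul_secondMoment_le (hS : (secondMoment P X).PosDef)
    (hcopy : ∀ i, IdentDistrib (Xs i) X μ P) (hindep : iIndepFun Xs μ) (hn : 0 < n) (c : ℝ) :
    μ {ω | ¬ c • secondMoment P X ≤ empSecondMoment fun i => Xs i ω} ≤
      Measure.pi (fun _ : Fin n => whitenedLaw P X)
        {w | ∃ v : Vec d, ∑ i, inner ℝ v (w i) ^ 2 < n * c * ‖v‖ ^ 2} := by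
  set W : Vec d → Vec d := app (sqrtM (secondMoment P X))⁻¹
  have hW : Measurable W := measurable_app _
  refine (measure_mono fun ω hω => ?_).trans (measure_sample_mem_le
    (fun i => (hcopy i).comp hW) (hindep.comp (fun _ => W) fun _ => hW) _)
  rw [Set.mem_ofPred_eq, smul_le_iff_inner_app_le hS.isHermitian
    (posSemidef_empSecondMoment _).isHermitian] at hω
  push Not at hω
  obtain ⟨v, hv⟩ := hω
  refine ⟨app (sqrtM (secondMoment P X)) v, ?_⟩
  simp only [Function.comp_apply, W, inner_app_sqrtM_inv hS, norm_app_sqrtM_sq hS.posSemidef]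
  rw [inner_app_empSecondMoment, inv_mul_lt_iff₀ (by positivity)] at hv
  rwa [mul_assoc]

theorem measure_sum_inner_gramSchmidtNormed_residual_sq_gt_le [IsProbabilityMeasure P]
    (hXm : Measurable X) (hYm : Measurable Y)
    (hcopy : ∀ i, IdentDistrib (fun ω => (Xs i ω, Ys i ω)) (fun ω => (X ω, Y ω)) μ P)
    (hindep : iIndepFun (fun i ω => (Xs i ω, Ys i ω)) μ)
    {σ : ℝ} (hnoise : SubgaussianNoise P X Y σ) (hmodel : ∀ᵐ ω ∂P, bias P X Y ω = 0)
    {s : ℝ} (hs : 0 ≤ s) :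
    μ {ω | σ ^ 2 * (d + 2 * √(d * s) + 2 * s) <
      ∑ j, inner ℝ (gramSchmidtNormed ℝ (designColumn fun i => Xs i ω) j)
        (WithLp.toLp 2 fun i => Ys i ω - inner ℝ (Xs i ω) (betaStar P X Y)) ^ 2} ≤
      ENNReal.ofReal (Real.exp (-s)) := by
  set T : Vec d × ℝ → Vec d × ℝ := fun z => (z.1, z.2 - inner ℝ z.1 (betaStar P X Y))
  have hT : Measurable T := by fun_prop
  have : IsProbabilityMeasure (P.map X) := Measure.isProbabilityMeasure_map hXm.aemeasurable
  have hcol : Measurable (designColumn : (Fin n → Vec d) → _) := by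
    unfold designColumn
    fun_prop
  have htail := measure_pi_sum_inner_gramSchmidtNormed_sq_gt_le
    (hasSubgaussianMGF_condDistrib_residual hXm hYm hnoise hmodel) hcol hs
  rw [compProd_map_condDistrib (by fun_prop), NNReal.coe_pow, coe_nnnorm, Real.norm_eq_abs,
    sq_abs] at htail
  exact (measure_sample_mem_le (fun i => (hcopy i).comp hT) (hindep.comp (fun _ => T) fun _ => hT)
    _).trans htail

theorem one_sub_le_measureReal_ols [IsProbabilityMeasure P] (hXm : Measurable X)
    (hYm : Measurable Y) (hS : (secondMoment P X).PosDef)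
    (hcopy : ∀ i, IdentDistrib (fun ω => (Xs i ω, Ys i ω)) (fun ω => (X ω, Y ω)) μ P)
    (hindep : iIndepFun (fun i ω => (Xs i ω, Ys i ω)) μ)
    {σ : ℝ} (hnoise : SubgaussianNoise P X Y σ) (hmodel : ∀ᵐ ω ∂P, bias P X Y ω = 0)
    {δ : ℝ} (hδ : δ ∈ Set.Ioo (0 : ℝ) 1) (hn : 0 < n) {K : ℝ} (hK : 0 < K)
    (htail : Measure.pi (fun _ : Fin n => whitenedLaw P X)
      {w | ∃ v : Vec d, ∑ i, inner ℝ v (w i) ^ 2 < n * K⁻¹ * ‖v‖ ^ 2} ≤ ENNReal.ofReal δ) :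
    1 - 2 * δ ≤ μ.real {ω |
      (empSecondMoment fun i => Xs i ω).PosDef ∧
      specNorm (sqrtM (secondMoment P X) * (empSecondMoment fun i => Xs i ω)⁻¹
          * sqrtM (secondMoment P X)) ≤ K ∧
      mNorm (secondMoment P X)
          (ols (fun i => Xs i ω) (fun i => Ys i ω) - betaStar P X Y) ^ 2
        ≤ K * rate d σ δ n} := by
  have hlog : 0 ≤ Real.log (1 / δ) := Real.log_nonneg (one_le_one_div hδ.1 hδ.2.le)
  have hdesign := (measure_not_smul_secondMoment_le hS (fun i => (hcopy i).comp measurable_fst)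
    (hindep.comp _ fun _ => measurable_fst) hn K⁻¹).trans htail
  have hresidual := measure_sum_inner_gramSchmidtNormed_residual_sq_gt_le hXm hYm hcopy hindep
    hnoise hmodel hlog
  rw [one_div, Real.log_inv, neg_neg, Real.exp_log hδ.1] at hresidual
  rw [two_mul]
  refine one_sub_add_le_measureReal (fun ω hω => ?_) hδ.1.le hδ.1.le hdesign hresidual
  simp only [Set.compl_union, Set.mem_inter_iff, Set.mem_compl_iff, Set.mem_ofPred_eq, not_not,
    not_lt, Function.comp_apply] at hω
  obtain ⟨hle, hres⟩ := hω
  have hT := posDef_of_smul_le (inv_pos.2 hK) hS hle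
  refine ⟨hT, specNorm_sqrtM_mul_inv_mul_sqrtM_le hK hS hle, ?_⟩
  refine (mNorm_sq_le_mul_mNorm_sq hK hS.posSemidef hT.posSemidef hle _).trans
    (mul_le_mul_of_nonneg_left ?_ hK.le)
  refine (mNorm_empSecondMoment_ols_sub_sq_le hT.det_pos.ne'.isUnit _ _).trans ?_
  rw [rate, one_div, Real.log_inv, inv_mul_eq_div]
  exact div_le_div_of_nonneg_right hres n.cast_nonneg

end Sampling

section SampleSize

variable {d n : ℕ} {ρ δ : ℝ}

theorem dimension_log_add_log_nonneg (hδ : δ ∈ Set.Ioo (0 : ℝ) 1) :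
    0 ≤ d * Real.log 41 + Real.log (2 / δ) := by
  have hlog : 0 ≤ Real.log (2 / δ) := Real.log_nonneg ((one_le_div hδ.1).2 (by linarith [hδ.2]))
  positivity

theorem log_dimension_div_nonneg (hδ : δ ∈ Set.Ioo (0 : ℝ) 1) : 0 ≤ Real.log (d / δ) := by
  rcases d.eq_zero_or_pos with rfl | hd
  · simp
  · have hd' : (1 : ℝ) ≤ d := by exact_mod_cast hd
    exact Real.log_nonneg ((one_le_div hδ.1).2 (hδ.2.le.trans hd'))

theorem pos_of_n₁_lt (hδ : δ ∈ Set.Ioo (0 : ℝ) 1) (hn : n₁ d ρ δ < n) : 0 < n := by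
  have := dimension_log_add_log_nonneg (d := d) hδ
  exact Nat.cast_pos.1 (lt_of_le_of_lt (by rw [n₁]; positivity) hn)

theorem pos_of_n₂_lt (hδ : δ ∈ Set.Ioo (0 : ℝ) 1) (hn : n₂ d ρ δ < n) : 0 < n := by
  have := log_dimension_div_nonneg (d := d) hδ
  exact Nat.cast_pos.1 (lt_of_le_of_lt (by rw [n₂]; positivity) hn)

theorem one_div_mem_Ioc_five {κ : ℝ} (hκ : 1 / 5 ≤ κ) : 1 / κ ∈ Set.Ioc 0 5 :=
  ⟨by positivity, by linarith [one_div_le_one_div_of_le (by norm_num) hκ]⟩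

theorem K₁_mem_Ioc (hρ : 1 ≤ ρ) (hδ : δ ∈ Set.Ioo (0 : ℝ) 1) (hn : n₁ d ρ δ < n) :
    K₁ d ρ δ n ∈ Set.Ioc 0 5 := by
  have hL := dimension_log_add_log_nonneg (d := d) hδ
  have hn0 : (0 : ℝ) < n := Nat.cast_pos.2 (pos_of_n₁_lt hδ hn)
  rw [n₁] at hn
  refine one_div_mem_Ioc_five ?_
  set L : ℝ := d * Real.log 41 + Real.log (2 / δ)
  have hρ0 : 0 < ρ := by linarith
  have hratio : L / n ≤ 1 / (70 * ρ ^ 2) := by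
    rw [div_le_div_iff₀ hn0 (by positivity)]
    linarith
  have hsqrt : √(32 * L / n) ≤ 17 / (25 * ρ) := by
    refine Real.sqrt_le_iff.2 ⟨by positivity, ?_⟩
    calc 32 * L / n = 32 * (L / n) := mul_div_assoc ..
      _ ≤ 32 * (1 / (70 * ρ ^ 2)) := by gcongr
      _ ≤ (17 / (25 * ρ)) ^ 2 := by
          field_simp
          norm_num
  have hlin : 2 * L / n ≤ 1 / (35 * ρ) := by
    calc 2 * L / n = 2 * (L / n) := mul_div_assoc ..
      _ ≤ 2 * (1 / (70 * ρ ^ 2)) := by gcongr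
      _ = 1 / (35 * ρ ^ 2) := by
          field_simp
          norm_num
      _ ≤ 1 / (35 * ρ) := by
          gcongr
          exact le_self_pow₀ hρ two_ne_zero
  have hbound : 10 * ρ / 9 * (√(32 * L / n) + 2 * L / n) ≤ 4 / 5 :=
    calc 10 * ρ / 9 * (√(32 * L / n) + 2 * L / n)
        ≤ 10 * ρ / 9 * (17 / (25 * ρ) + 1 / (35 * ρ)) := by gcongr
      _ ≤ 4 / 5 := by
          field_simp
          norm_num
  linarith

theorem K₂_mem_Ioc (hδ : δ ∈ Set.Ioo (0 : ℝ) 1) (hn : n₂ d ρ δ < n) :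
    K₂ d ρ δ n ∈ Set.Ioc 0 5 := by
  have hn0 : (0 : ℝ) < n := Nat.cast_pos.2 (pos_of_n₂_lt hδ hn)
  rw [n₂] at hn
  have := log_dimension_div_nonneg (d := d) hδ
  have hsqrt : √(2 * ρ ^ 2 * d * Real.log (d / δ) / n) ≤ 4 / 5 := by
    refine Real.sqrt_le_iff.2 ⟨by norm_num, ?_⟩
    rw [div_le_iff₀ hn0]
    linarith
  exact one_div_mem_Ioc_five (by linarith)

end SampleSize

section WhitenedTail

variable {Ω : Type*} [MeasurableSpace Ω] {P : Measure Ω} [IsProbabilityMeasure P] {d n : ℕ}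
  {X : Ω → Vec d} {ρ δ : ℝ}

theorem SubgaussianProjections.measure_pi_whitenedLaw_le (hρ : SubgaussianProjections P X ρ)
    (hXm : Measurable X) (hX : MemLp X 2 P) (hS : (secondMoment P X).PosDef)
    (hδ : δ ∈ Set.Ioo (0 : ℝ) 1) (hn : 0 < n) :
    Measure.pi (fun _ : Fin n => whitenedLaw P X)
      {w | ∃ v : Vec d, ∑ i, inner ℝ v (w i) ^ 2 < n * (K₁ d ρ δ n)⁻¹ * ‖v‖ ^ 2} ≤
      ENNReal.ofReal δ := by
  have := isProbabilityMeasure_whitenedLaw (P := P) hXm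
  set L : ℝ := d * Real.log 41 + Real.log (2 / δ) with hL
  have hn' : (0 : ℝ) < n := Nat.cast_pos.2 hn
  have hK : (n : ℝ) * (K₁ d ρ δ n)⁻¹ = n - 10 * ρ / 9 * (√(32 * n * L) + 2 * L) := by
    have hsqrt : n * √(32 * L / n) = √(32 * n * L) := by
      rw [← Real.sqrt_sq hn'.le, ← Real.sqrt_mul (by positivity), Real.sqrt_sq hn'.le]
      congr 1
      field_simp
    rw [K₁, one_div, inv_inv, ← hL, ← hsqrt]
    field_simp
  have hexp : (41 : ℝ) ^ d * (2 * Real.exp (-L)) = δ := by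
    rw [hL, neg_add, Real.exp_add, Real.exp_neg (Real.log _), Real.exp_neg, Real.exp_nat_mul,
      Real.exp_log (by norm_num), Real.exp_log (div_pos two_pos hδ.1)]
    field_simp
  have htail := (isIsotropic_whitenedLaw hXm hX hS).measure_pi_exists_sum_sq_lt_le_of_subgaussian
    (hasSubgaussianVectorMGF_whitenedLaw hXm hρ) (one_pos.trans_le hρ.1) n
    (dimension_log_add_log_nonneg (d := d) hδ)
  rwa [finrank_euclideanSpace_fin, ← hL, hexp, ← hK] at htail

theorem BoundedLeverage.measure_pi_whitenedLaw_le (hρ : BoundedLeverage P X ρ)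
    (hXm : Measurable X) (hX : MemLp X 2 P) (hS : (secondMoment P X).PosDef)
    (hδ : δ ∈ Set.Ioo (0 : ℝ) 1) (hn : 0 < n) :
    Measure.pi (fun _ : Fin n => whitenedLaw P X)
      {w | ∃ v : Vec d, ∑ i, inner ℝ v (w i) ^ 2 < n * (K₂ d ρ δ n)⁻¹ * ‖v‖ ^ 2} ≤
      ENNReal.ofReal δ := by
  rcases d.eq_zero_or_pos with rfl | hd
  · refine (measure_mono_null (t := ∅) ?_ measure_empty).trans_le zero_le
    rintro w ⟨v, hv⟩
    simp [Subsingleton.elim v 0] at hv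
  have := isProbabilityMeasure_whitenedLaw (P := P) hXm
  have hd' : (0 : ℝ) < d := Nat.cast_pos.2 hd
  have : (0 : ℝ) < n := Nat.cast_pos.2 hn
  have hρ0 : 0 < ρ := one_pos.trans_le hρ.1
  have hlog := log_dimension_div_nonneg (d := d) hδ
  have hexponent : n * √(2 * ρ ^ 2 * d * Real.log (d / δ) / n) ^ 2 / (2 * (ρ ^ 2 * d)) =
      Real.log (d / δ) := by
    rw [Real.sq_sqrt (by positivity)]
    field_simp
  have htail := (isIsotropic_whitenedLaw hXm hX hS).measure_pi_exists_sum_sq_lt_le_of_bounded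
    (B := ρ ^ 2 * d) (by positivity) (Real.sqrt_nonneg _) (norm_sq_le_of_boundedLeverage hXm hρ) n
    (t := √(2 * ρ ^ 2 * d * Real.log (d / δ) / n))
  rwa [hexponent, Real.exp_neg, Real.exp_log (div_pos hd' hδ.1), finrank_euclideanSpace_fin,
    inv_div, mul_div_cancel₀ _ hd'.ne', ← inv_inv (1 - _), ← one_div (1 - _)] at htail

end WhitenedTail

end RandomDesign

end

theorem theorem1
    {Ω₀ Ω : Type*} [MeasurableSpace Ω₀] [MeasurableSpace Ω]
    -- the population pair `(X, Y)`
    (P : Measure Ω₀) [IsProbabilityMeasure P] {d : ℕ}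
    (X : Ω₀ → RandomDesign.Vec d) (Y : Ω₀ → ℝ)
    (hXm : Measurable X) (hYm : Measurable Y)
    (hX : MemLp X 2 P) (hY : Integrable Y P)
    (hSigma : IsUnit (RandomDesign.secondMoment P X).det)
    -- the sample: independent copies of `(X, Y)`
    (μ : Measure Ω) [IsProbabilityMeasure μ] {n : ℕ}
    (Xs : Fin n → Ω → RandomDesign.Vec d) (Ys : Fin n → Ω → ℝ)
    (hcopy : ∀ i, IdentDistrib (fun ω => (Xs i ω, Ys i ω)) (fun ω => (X ω, Y ω)) μ P)
    (hindep : iIndepFun (fun i ω => (Xs i ω, Ys i ω)) μ)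
    -- subgaussian noise and correct model
    (σ : ℝ) (hnoise : RandomDesign.SubgaussianNoise P X Y σ)
    (hmodel : ∀ᵐ ω ∂P, RandomDesign.bias P X Y ω = 0)
    (δ : ℝ) (hδ : δ ∈ Set.Ioo (0 : ℝ) 1) :
    (∀ ρ : ℝ, RandomDesign.SubgaussianProjections P X ρ → RandomDesign.n₁ d ρ δ < n →
      RandomDesign.K₁ d ρ δ n ≤ 5 ∧
      1 - 2 * δ ≤ μ.real {ω |
        (RandomDesign.empSecondMoment fun i => Xs i ω).PosDef ∧
        RandomDesign.specNorm
            (RandomDesign.sqrtM (RandomDesign.secondMoment P X)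
              * (RandomDesign.empSecondMoment fun i => Xs i ω)⁻¹
              * RandomDesign.sqrtM (RandomDesign.secondMoment P X))
          ≤ RandomDesign.K₁ d ρ δ n ∧
        RandomDesign.mNorm (RandomDesign.secondMoment P X)
            (RandomDesign.ols (fun i => Xs i ω) (fun i => Ys i ω)
              - RandomDesign.betaStar P X Y) ^ 2
          ≤ RandomDesign.K₁ d ρ δ n * RandomDesign.rate d σ δ n}) ∧
    (∀ ρ : ℝ, RandomDesign.BoundedLeverage P X ρ → RandomDesign.n₂ d ρ δ < n →
      RandomDesign.K₂ d ρ δ n ≤ 5 ∧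
      1 - 2 * δ ≤ μ.real {ω |
        (RandomDesign.empSecondMoment fun i => Xs i ω).PosDef ∧
        RandomDesign.specNorm
            (RandomDesign.sqrtM (RandomDesign.secondMoment P X)
              * (RandomDesign.empSecondMoment fun i => Xs i ω)⁻¹
              * RandomDesign.sqrtM (RandomDesign.secondMoment P X))
          ≤ RandomDesign.K₂ d ρ δ n ∧
        RandomDesign.mNorm (RandomDesign.secondMoment P X)
            (RandomDesign.ols (fun i => Xs i ω) (fun i => Ys i ω)
              - RandomDesign.betaStar P X Y) ^ 2
          ≤ RandomDesign.K₂ d ρ δ n * RandomDesign.rate d σ δ n}) := by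
  have hS := RandomDesign.posDef_secondMoment hX hSigma
  refine ⟨fun ρ hρ hn => ?_, fun ρ hρ hn => ?_⟩
  · have hn0 := RandomDesign.pos_of_n₁_lt hδ hn
    have hK := RandomDesign.K₁_mem_Ioc hρ.1 hδ hn
    exact ⟨hK.2, RandomDesign.one_sub_le_measureReal_ols hXm hYm hS hcopy hindep hnoise hmodel hδ
      hn0 hK.1 (hρ.measure_pi_whitenedLaw_le hXm hX hS hδ hn0)⟩
  · have hn0 := RandomDesign.pos_of_n₂_lt hδ hn
    have hK := RandomDesign.K₂_mem_Ioc hδ hn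
    exact ⟨hK.2, RandomDesign.one_sub_le_measureReal_ols hXm hYm hS hcopy hindep hnoise hmodel hδ
      hn0 hK.1 (hρ.measure_pi_whitenedLaw_le hXm hX hS hδ hn0)⟩
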